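/- **Logic.** An interval in a linear order $\mathfrak T=(T,\le)$ is a pair $\langle x,y\rangle$ with $x,y\in T$ and $x\le y$. Allen's interval relations between $\langle x_1,y_1\rangle$ and $\langle x_2,y_2\rangle$ are: $\mathsf A$ ($y_1=x_2$ and $x_2<y_2$), $\mathsf B$ ($x_1=x_2$ and $y_2<y_1$), $\mathsf E$ ($x_1<x_2$ and $y_1=y_2$), $\mathsf D$ ($x_1<x_2$ and $y_2<y_1$), $\mathsf L$ ($y_1<x_2$), $\mathsf O$ ($x_1<x_2<y_1<y_2$), and their inverses $\bar{\mathsf A},\bar{\mathsf B},\bar{\mathsf E},\bar{\mathsf D},\bar{\mathsf L},\bar{\mathsf O}$. Each of the twelve relations is read either irreflexively (as just given) or reflexively (with every $<$ in its definition replaced by $\le$); a *semantics* is a choice of one of the two readings for each of the twelve relations separately. Literals are given by $\lambda ::= \top\mid\bot\mid p\mid\langle\mathsf R\rangle\lambda\mid[\mathsf R]\lambda$, where $p$ is a propositional variable and $\mathsf R$ an interval relation, and $\mathcal{HS}_{core}$-formulas by $$\varphi ::= \lambda \mid [\mathsf U](\lambda_1\to\lambda_2)\mid[\mathsf U](\lambda_1\land\lambda_2\to\bot)\mid\varphi_1\land\varphi_2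 .$$ A model based on $\mathfrak T$ assigns a set of intervals in $\mathfrak T$ to every propositional variable; $\langle\mathsf R\rangle$ and $[\mathsf R]$ are the usual diamond and box over the relation $\mathsf R$, and $[\mathsf U]$ quantifies over all intervals. For a class $\mathcal C$ of linear orders, $\varphi$ is $\mathcal C$-satisfiable (under a given semantics) if it holds at some interval of some model based on an order in $\mathcal C$. Formulas are written as words over a finite alphabet in prefix notation, with the indices of variables in unary. A decision problem is $\textsc{PSpace}$-hard if every language (over any finite alphabet) decided by a deterministic Turing machine in polynomial space is reducible to it by a polynomial-time computable many-one reduction. **Theorem.** Fix any semantics. (i) For every class $\mathcal C$ of linear orders that contains an infinite order, $\mathcal C$-satisfiability of $\mathcal{HS}_{core}$-formulas is $\textsc{PSpace}$-hard. (ii) Satisfiability of $\mathcal{HS}_{core}$-formulas over the class $\mathsf{Fin}$ of all finite linear orders is $\textsc{PSpace}$-hard. -/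

import Mathlib

universe u

namespace HS

/-! ### Interval relations -/

/-- Allen's twelve interval relations: After, Begins, Ends, During, Later, Overlaps
and their inverses. -/
inductive IntervalRel
  | after | begins | ends | during | later | overlaps
  | afterInv | beginsInv | endsInv | duringInv | laterInv | overlapsInv
  deriving DecidableEq

/-- An interval relation is read either with the strict order `<` (irreflexive semantics)
or with `≤` in place of every `<` (reflexive semantics). -/
inductive Semantics
  | irreflexive | reflexive

/-- The order relation used in the definition of an interval relation. -/
def Semantics.lt {T : Type*} [LinearOrder T] : Semantics → T → T → Prop
  | .irreflexive, x, y => x < y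
  | .reflexive, x, y => x ≤ y

/-- `R.holds s I J` : the interval `I = ⟨x₁, y₁⟩` is in the relation `R` to the interval
`J = ⟨x₂, y₂⟩`, where `R` is read under the semantics `s`. Intervals are pairs `x ≤ y`; punctual
intervals are allowed. -/
def IntervalRel.holds {T : Type*} [LinearOrder T] (s : Semantics) :
    IntervalRel → NonemptyInterval T → NonemptyInterval T → Prop
  | .after, I, J => I.snd = J.fst ∧ s.lt J.fst J.snd
  | .begins, I, J => I.fst = J.fst ∧ s.lt J.snd I.snd
  | .ends, I, J => s.lt I.fst J.fst ∧ I.snd = J.snd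
  | .during, I, J => s.lt I.fst J.fst ∧ s.lt J.snd I.snd
  | .later, I, J => s.lt I.snd J.fst
  | .overlaps, I, J => s.lt I.fst J.fst ∧ s.lt J.fst I.snd ∧ s.lt I.snd J.snd
  | .afterInv, I, J => J.snd = I.fst ∧ s.lt J.fst J.snd
  | .beginsInv, I, J => I.fst = J.fst ∧ s.lt I.snd J.snd
  | .endsInv, I, J => s.lt J.fst I.fst ∧ I.snd = J.snd
  | .duringInv, I, J => s.lt J.fst I.fst ∧ s.lt I.snd J.snd
  | .laterInv, I, J => s.lt J.snd I.fst
  | .overlapsInv, I, J => s.lt J.fst I.fst ∧ s.lt I.fst J.snd ∧ s.lt J.snd I.snd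

/-! ### Syntax -/

/-- Positive temporal literals; the propositional variables are indexed by `ℕ`. -/
inductive Literal
  | top
  | bot
  | var (p : ℕ)
  | dia (R : IntervalRel) (l : Literal)
  | box (R : IntervalRel) (l : Literal)

/-- Formulas of the core fragment: conjunctions of initial conditions `l`, of clauses
`[U](l₁ → l₂)` and of clauses `[U](l₁ ∧ l₂ → ⊥)`. -/
inductive CoreFormula
  | init (l : Literal)
  | imp (l₁ l₂ : Literal)
  | disj (l₁ l₂ : Literal)
  | and (φ ψ : CoreFormula)

/-! ### Semantics -/

/-- Truth of a literal at an interval. The choice `sem` fixes, for each of the twelve relations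
separately, whether it is reflexive or irreflexive; `ν` is the valuation. -/
def Literal.Holds {T : Type*} [LinearOrder T] (sem : IntervalRel → Semantics)
    (ν : ℕ → Set (NonemptyInterval T)) : Literal → NonemptyInterval T → Prop
  | .top, _ => True
  | .bot, _ => False
  | .var p, I => I ∈ ν p
  | .dia R l, I => ∃ J, R.holds (sem R) I J ∧ l.Holds sem ν J
  | .box R l, I => ∀ J, R.holds (sem R) I J → l.Holds sem ν J

/-- Truth of a core formula at an interval. -/
def CoreFormula.Holds {T : Type*} [LinearOrder T] (sem : IntervalRel → Semantics)
    (ν : ℕ → Set (NonemptyInterval T)) : CoreFormula → NonemptyInterval T → Prop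
  | .init l, I => l.Holds sem ν I
  | .imp l₁ l₂, _ => ∀ J, l₁.Holds sem ν J → l₂.Holds sem ν J
  | .disj l₁ l₂, _ => ∀ J, ¬ (l₁.Holds sem ν J ∧ l₂.Holds sem ν J)
  | .and φ ψ, I => φ.Holds sem ν I ∧ ψ.Holds sem ν I

/-- The core formulas that hold at some interval of some model based on an order from the
class `C`: the satisfiability problem of the core fragment over `C`. -/
def CoreSat (C : Set LinOrd.{u}) (sem : IntervalRel → Semantics) : Set CoreFormula :=
  {φ | ∃ T ∈ C, ∃ (ν : ℕ → Set (NonemptyInterval T)) (I : NonemptyInterval T), φ.Holds sem ν I}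

/-! ### Formulas as words over a finite alphabet -/

/-- The finite alphabet in which formulas are written. -/
inductive Token
  | top | bot
  | tick | var
  | dia (R : IntervalRel)
  | box (R : IntervalRel)
  | init | imp | disj | and
  deriving DecidableEq

/-- Prefix notation; the variable with index `p` is written with its index in unary. -/
def Literal.encode : Literal → List Token
  | .top => [.top]
  | .bot => [.bot]
  | .var p => List.replicate p .tick ++ [.var]
  | .dia R l => .dia R :: l.encode
  | .box R l => .box R :: l.encode

/-- Prefix notation. -/
def CoreFormula.encode : CoreFormula → List Token
  | .init l => .init :: l.encode
  | .imp l₁ l₂ => .imp :: (l₁.encode ++ l₂.encode)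
  | .disj l₁ l₂ => .disj :: (l₁.encode ++ l₂.encode)
  | .and φ ψ => .and :: (φ.encode ++ ψ.encode)

end HS

/-! ### Polynomial space and hardness -/

namespace PolySpace

/-- Head movements. -/
inductive Move
  | left | stay | right

/-- The displacement of the head. -/
def Move.shift : Move → ℤ
  | .left => -1
  | .stay => 0
  | .right => 1

/-- A deterministic single-tape Turing machine with input alphabet `A`. The machine halts when
`δ` is undefined, and it then accepts if its state is in `accept`. -/
structure Machine (A : Type) where
  /-- states -/
  State : Type
  /-- tape symbols -/
  Sym : Type
  [stateFin : Fintype State]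
  [symFin : Fintype Sym]
  /-- the blank symbol -/
  blank : Sym
  /-- the input symbols are tape symbols different from the blank -/
  input : A ↪ Sym
  input_ne_blank : ∀ a, input a ≠ blank
  start : State
  accept : Set State
  /-- the transition function: new state, symbol written, head movement -/
  δ : State → Sym → Option (State × Sym × Move)

namespace Machine

variable {A : Type} (M : Machine A)

/-- Configurations: state, head position, and contents of the two-way infinite tape. -/
structure Cfg where
  state : M.State
  head : ℤ
  tape : ℤ → M.Sym

/-- One step of the computation; `none` if the machine has halted. -/
def step (c : M.Cfg) : Option M.Cfg :=
  (M.δ c.state (c.tape c.head)).map fun r =>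
    { state := r.1
      head := c.head + r.2.2.shift
      tape := Function.update c.tape c.head r.2.1 }

/-- The tape with the word `w` in the cells `0, 1, …, |w| - 1` and blanks elsewhere. -/
def initTape (w : List A) : ℤ → M.Sym
  | Int.ofNat k => (w[k]?).elim M.blank M.input
  | Int.negSucc _ => M.blank

/-- The initial configuration on input `w`: the head scans cell `0`. -/
def init (w : List A) : M.Cfg :=
  { state := M.start, head := 0, tape := M.initTape w }

end Machine

/-- `L` is in PSPACE: some machine halts on every input `w`, accepting exactly the words of `L`,
while its head never leaves the cells `-p(|w|), …, p(|w|)`, for a fixed polynomial `p`. -/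
def InPSpace {A : Type} (L : Language A) : Prop :=
  ∃ (M : Machine A) (p : Polynomial ℕ), ∀ w : List A,
    (∀ c, StateTransition.Reaches M.step (M.init w) c → |c.head| ≤ (p.eval w.length : ℕ)) ∧
    ∃ c, StateTransition.Reaches M.step (M.init w) c ∧ M.step c = none ∧
      (c.state ∈ M.accept ↔ w ∈ L)

/-- The decision problem `S`, for objects written as words by `enc`, is PSPACE-hard: every
language in PSPACE has a polynomial-time many-one reduction to `S`. -/
def PSpaceHard {α Γ : Type} (enc : α → List Γ) (S : Set α) : Prop :=
  ∀ (A : Type) [Fintype A] (L : Language A), InPSpace L →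
    ∃ f : List A → α,
      Nonempty (Turing.TM2ComputableInPolyTime (id : List A → List A) enc f) ∧
      ∀ w, w ∈ L ↔ f w ∈ S

end PolySpace

/-! ### Structured stack programs -/

/-! A clause has at most two literals and no disjunction in its conclusion, so every choice has to
come from the order. Take an interval `U` and force a marker `R` with the same left end and
unspecified length. Either `R` reaches the right end of `U`, or it is strictly shorter. In the
second case a variable `cov` that is forced above `R` and at and below `U` holds at all intervals
with this left end (`covers`), which a clause with premise `[A] cov` can detect. In this way the
clauses say: the marker is long, or something else happens at this left end.

Configurations of the machine are encoded by intervals called units, of alternating parity. At the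
end of each unit starts a candidate `pre` with a marker of its own. If this marker is long, the
machine must have accepted; if it is short, a unit of the other parity starts there. At a unit,
every tape cell tries the possible windows (contents of three neighbouring cells) one after another
until the marker of one is long, and the last window must not fail; this selects a window
(`exists_mark`). A long marker puts `low` on its own unit. It also puts `seen` on the following
candidate or unit, beyond whose end `far` forbids it to reach. Clauses that exclude pairs of `low`
and `seen` thus compare consecutive configurations. Two literals suffice, since the new content of a
cell is a function of one window, and each component of the next windows is compared with it
separately.

Models yield acceptance (`UnitFor.step`, `accepts_of_conditions`): the computation is followed unit
by unit. Since the machine is known to halt, any linear order will do. Conversely, an accepting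
computation of `m` steps is laid out on `3 * m + 10` points (`exists_conditions`), so only
arbitrarily long finite chains are needed. The two readings of the relations are treated at once:
`<` implies each of them, each of them implies `≤`, and the clauses treat boundary cases separately.

The formula is a concatenation of fixed blocks, one for each cell, with variable indices shifted
linearly in the number of the cell. A stack program writes it in polynomial time
(`polyRun_blockProg`, `Prog.computableInPolyTime`). -/

namespace StackProg

open Turing

variable {K : Type} {Γ : K → Type}

/-- Structured programs over finitely many stacks. `pop k body` pops a symbol `γ` from stack `k`
and runs `body γ` (nothing if the stack is empty); `each k body` repeats this until stack `k` is
empty. -/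
inductive Prog (Γ : K → Type)
  | skip
  | push (k : K) (γ : Γ k)
  | seq (p q : Prog Γ)
  | pop (k : K) (body : Γ k → Prog Γ)
  | each (k : K) (body : Γ k → Prog Γ)

/-- Program points. -/
def Prog.Label : Prog Γ → Type
  | .skip => Unit
  | .push _ _ => Unit
  | .seq p q => p.Label ⊕ q.Label
  | .pop k body => Option (Σ γ : Γ k, (body γ).Label)
  | .each k body => Option (Σ γ : Γ k, (body γ).Label)

/-- The first program point. -/
def Prog.entry : (p : Prog Γ) → p.Label
  | .skip => ()
  | .push _ _ => ()
  | .seq p _ => .inl p.entry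
  | .pop _ _ => none
  | .each _ _ => none

theorem Prog.finite_label [∀ k, Finite (Γ k)] : (p : Prog Γ) → Finite p.Label
  | .skip => inferInstanceAs (Finite Unit)
  | .push _ _ => inferInstanceAs (Finite Unit)
  | .seq p q =>
    have := p.finite_label
    have := q.finite_label
    inferInstanceAs (Finite (p.Label ⊕ q.Label))
  | .pop k body =>
    have := fun γ => (body γ).finite_label
    inferInstanceAs (Finite (Option (Σ γ : Γ k, (body γ).Label)))
  | .each k body =>
    have := fun γ => (body γ).finite_label
    inferInstanceAs (Finite (Option (Σ γ : Γ k, (body γ).Label)))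

/-- The registers of the compiled machine: the symbol last popped from each stack. -/
abbrev Reg (Γ : K → Type) : Type := ∀ k, Option (Γ k)

variable [DecidableEq K]

/-- The statements of the compiled program; `emb` embeds its program points into the labels of the
machine, and `exit` is the label at which the machine continues. -/
def Prog.code {L : Type} : (p : Prog Γ) → (p.Label → L) → L → p.Label → TM2.Stmt Γ L (Reg Γ)
  | .skip, _, exit, _ => .goto fun _ => exit
  | .push k γ, _, exit, _ => .push k (fun _ => γ) (.goto fun _ => exit)
  | .seq p q, emb, exit, l =>
    match l with
    | .inl l => p.code (fun l => emb (.inl l)) (emb (.inr q.entry)) l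
    | .inr l => q.code (fun l => emb (.inr l)) exit l
  | .pop k body, emb, exit, l =>
    match l with
    | none => .pop k (fun v o => Function.update v k o)
        (.goto fun v => (v k).elim exit fun γ => emb (some ⟨γ, (body γ).entry⟩))
    | some ⟨γ, l⟩ => (body γ).code (fun l => emb (some ⟨γ, l⟩)) exit l
  | .each k body, emb, exit, l =>
    match l with
    | none => .pop k (fun v o => Function.update v k o)
        (.goto fun v => (v k).elim exit fun γ => emb (some ⟨γ, (body γ).entry⟩))
    | some ⟨γ, l⟩ => (body γ).code (fun l => emb (some ⟨γ, l⟩)) (emb none) l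

/-- `Run p S S' t`: started with stacks `S`, the program `p` ends with stacks `S'` after `t`
machine steps. -/
inductive Run : Prog Γ → (∀ k, List (Γ k)) → (∀ k, List (Γ k)) → ℕ → Prop
  | skip (S) : Run .skip S S 1
  | push (k γ S) : Run (.push k γ) S (Function.update S k (γ :: S k)) 1
  | seq {p q S S' S'' m n} : Run p S S' m → Run q S' S'' n → Run (.seq p q) S S'' (m + n)
  | pop_nil {k body S} : S k = [] → Run (.pop k body) S S 1
  | pop_cons {k body S γ l S' m} : S k = γ :: l →
      Run (body γ) (Function.update S k l) S' m → Run (.pop k body) S S' (1 + m)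
  | each_nil {k body S} : S k = [] → Run (.each k body) S S 1
  | each_cons {k body S γ l S' S'' m n} : S k = γ :: l →
      Run (body γ) (Function.update S k l) S' m → Run (.each k body) S' S'' n →
      Run (.each k body) S S'' (1 + m + n)

/-- `p` reaches `S'` from `S` within `t` machine steps. -/
def RunLE (p : Prog Γ) (S S' : ∀ k, List (Γ k)) (t : ℕ) : Prop := ∃ t' ≤ t, Run p S S' t'

theorem iterate_bind_trans {σ : Type*} {f : σ → Option σ} {m n : ℕ} {a b : σ} {c : Option σ}
    (h₁ : (flip bind f)^[m] (some a) = some b) (h₂ : (flip bind f)^[n] (some b) = c) :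
    (flip bind f)^[m + n] (some a) = c := by
  rw [add_comm, Function.iterate_add_apply, h₁, h₂]

/-- Induction on the run, with `emb`, `exit` and the registers arbitrary, since subprograms sit at
other labels of the same machine and continue elsewhere. The registers need no invariant: a jump
reads only the register that the `pop` before it has just overwritten. -/
theorem Run.exec {p : Prog Γ} {S S' : ∀ k, List (Γ k)} {t : ℕ} (h : Run p S S' t) {L : Type}
    {M : L → TM2.Stmt Γ L (Reg Γ)} {emb : p.Label → L} {exit : L}
    (hM : ∀ l, M (emb l) = p.code emb exit l) (v : Reg Γ) :
    ∃ v', (flip bind (TM2.step M))^[t] (some ⟨some (emb p.entry), v, S⟩) =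
      some ⟨some exit, v', S'⟩ := by
  induction h generalizing exit v with
  | skip S =>
    refine ⟨v, ?_⟩
    simp [flip, hM, Prog.code, TM2.step]
  | push k γ S =>
    refine ⟨v, ?_⟩
    simp [flip, hM, Prog.code, TM2.step]
  | @seq p q S S' S'' m n _ _ ih₁ ih₂ =>
    obtain ⟨v₁, h₁⟩ := ih₁ (emb := fun l => emb (.inl l)) (exit := emb (.inr q.entry))
      (fun l => hM (.inl l)) v
    obtain ⟨v₂, h₂⟩ := ih₂ (emb := fun l => emb (.inr l)) (exit := exit)
      (fun l => hM (.inr l)) v₁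
    exact ⟨v₂, iterate_bind_trans h₁ h₂⟩
  | @pop_nil k body S hS =>
    have : M (emb (Prog.pop k body).entry) = _ := hM none
    refine ⟨Function.update v k none, ?_⟩
    simp [flip, this, Prog.code, TM2.step, hS]
  | @pop_cons k body S γ l S' m hS _ ih =>
    have : M (emb (Prog.pop k body).entry) = _ := hM none
    obtain ⟨v₁, h₁⟩ := ih (emb := fun l => emb (some ⟨γ, l⟩)) (exit := exit)
      (fun l => hM (some ⟨γ, l⟩)) (Function.update v k (some γ))
    refine ⟨v₁, iterate_bind_trans ?_ h₁⟩
    simp [flip, this, Prog.code, TM2.step, hS]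
  | @each_nil k body S hS =>
    have : M (emb (Prog.each k body).entry) = _ := hM none
    refine ⟨Function.update v k none, ?_⟩
    simp [flip, this, Prog.code, TM2.step, hS]
  | @each_cons k body S γ l S' S'' m n hS _ _ ih₁ ih₂ =>
    have : M (emb (Prog.each k body).entry) = _ := hM none
    obtain ⟨v₁, h₁⟩ := ih₁ (emb := fun l => emb (some ⟨γ, l⟩)) (exit := emb none)
      (fun l => hM (some ⟨γ, l⟩)) (Function.update v k (some γ))
    obtain ⟨v₂, h₂⟩ := ih₂ (emb := emb) (exit := exit) hM v₁
    refine ⟨v₂, iterate_bind_trans (iterate_bind_trans ?_ h₁) h₂⟩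
    simp [flip, this, Prog.code, TM2.step, hS]

/-- Mathlib's `initList` and `haltList` describe the stacks by a `dite` with a cast; this translates
them to `Function.update`. -/
theorem dite_eq_update (k₀ k : K) (w : List (Γ k₀)) (d : Decidable (k = k₀)) :
    (@dite (List (Γ k)) (k = k₀) d (fun h => by rw [h]; exact w) fun _ => []) =
      Function.update (fun _ => []) k₀ w k := by
  by_cases hk : k = k₀
  · subst hk; simp
  · simp [hk]

/-! ### Compilation into a stack machine -/

section Machine

variable [Fintype K] [∀ k, Finite (Γ k)]

/-- The machine that runs the program `p` with input stack `k₀` and output stack `k₁`. -/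
noncomputable def Prog.toFinTM2 (p : Prog Γ) (k₀ k₁ : K) : FinTM2 :=
  have := p.finite_label
  { K := K
    k₀ := k₀
    k₁ := k₁
    Γ := Γ
    Λ := Option p.Label
    main := some p.entry
    ΛFin := Fintype.ofFinite _
    σ := Reg Γ
    initialState := fun _ => none
    σFin := Fintype.ofFinite _
    Γk₀Fin := Fintype.ofFinite _
    m := fun l => match l with
      | some l => p.code some none l
      -- `haltList` requires the initial registers, so they are reset before halting. This is the
      -- one extra step in the time bound.
      | none => .load (fun _ _ => none) .halt }

/-- A program that computes `f` within polynomially many steps, leaving all stacks but the output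
stack empty, witnesses that `f` is computable in polynomial time. -/
theorem Prog.computableInPolyTime (p : Prog Γ) (k₀ k₁ : K) {α : Type} {eb : α → List (Γ k₁)}
    {f : List (Γ k₀) → α} (time : Polynomial ℕ)
    (h : ∀ w, RunLE p (Function.update (fun _ => []) k₀ w)
      (Function.update (fun _ => []) k₁ (eb (f w))) (time.eval w.length)) :
    Nonempty (TM2ComputableInPolyTime (id : List (Γ k₀) → List (Γ k₀)) eb f) := by
  refine ⟨{ tm := p.toFinTM2 k₀ k₁, inputAlphabet := Equiv.refl _, outputAlphabet := Equiv.refl _,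
            time := time + 1, outputsFun := fun w => ?_ }⟩
  have hw := h w
  have key : ∃ t ≤ (time + 1).eval w.length,
      (flip bind (p.toFinTM2 k₀ k₁).step)^[t] (some (initList (p.toFinTM2 k₀ k₁) w)) =
        some (haltList (p.toFinTM2 k₀ k₁) (eb (f w))) := by
    obtain ⟨t, ht, hrun⟩ := hw
    refine ⟨t + 1, by simpa using ht, ?_⟩
    obtain ⟨v, hv⟩ := hrun.exec (L := Option p.Label) (M := (p.toFinTM2 k₀ k₁).m) (emb := some)
      (exit := none) (fun l => rfl) (fun _ => none)
    refine iterate_bind_trans (b := ⟨some none, v, _⟩) (Eq.trans ?_ hv) ?_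
    · congr 2
      unfold initList
      congr 1
      exact funext fun k => dite_eq_update k₀ k w _
    · simp only [flip, toFinTM2, Function.iterate_one]
      refine congrArg some ?_
      unfold haltList
      simp only [TM2.stepAux]
      congr 1
      exact funext fun k => (dite_eq_update k₁ k _ _).symm
  have ht := key.choose_spec
  exact ⟨⟨key.choose, by
    convert ht.2 using 3
    · exact congrArg _ (List.map_id _)
    · exact congrArg (fun l => some (haltList _ l)) (List.map_id _)⟩, by simpa using ht.1⟩

end Machine

end StackProg

namespace StackProg

/-! ### Running times -/

section Time

variable {K : Type} {Γ : K → Type} [DecidableEq K]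

theorem RunLE.mono {p : Prog Γ} {S S' : ∀ k, List (Γ k)} {s t : ℕ} (h : RunLE p S S' s)
    (hst : s ≤ t) : RunLE p S S' t :=
  let ⟨t', ht', hr⟩ := h
  ⟨t', ht'.trans hst, hr⟩

theorem RunLE.skip (S : ∀ k, List (Γ k)) : RunLE .skip S S 1 := ⟨1, le_rfl, .skip S⟩

theorem RunLE.push {k : K} {γ : Γ k} {S S' : ∀ k, List (Γ k)}
    (h : Function.update S k (γ :: S k) = S') : RunLE (.push k γ) S S' 1 :=
  ⟨1, le_rfl, h ▸ .push k γ S⟩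

theorem RunLE.seq {p q : Prog Γ} {S S' S'' : ∀ k, List (Γ k)} {m n : ℕ} (h₁ : RunLE p S S' m)
    (h₂ : RunLE q S' S'' n) : RunLE (.seq p q) S S'' (m + n) :=
  let ⟨_, hm, hr₁⟩ := h₁
  let ⟨_, hn, hr₂⟩ := h₂
  ⟨_, add_le_add hm hn, .seq hr₁ hr₂⟩

theorem RunLE.pop {k : K} {body : Γ k → Prog Γ} {S S' : ∀ k, List (Γ k)} {γ : Γ k}
    {l : List (Γ k)} {t : ℕ} (hS : S k = γ :: l)
    (h : RunLE (body γ) (Function.update S k l) S' t) : RunLE (.pop k body) S S' (1 + t) :=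
  let ⟨_, ht, hr⟩ := h
  ⟨_, by omega, .pop_cons hS hr⟩

/-- A loop over stack `k`, as a fold: `G l a` are the stacks when `l` is left on stack `k` and the
loop has computed `a`. -/
theorem RunLE.each {k : K} {body : Γ k → Prog Γ} {X : Type} (G : List (Γ k) → X → ∀ k, List (Γ k))
    (f : X → Γ k → X) (t : ℕ) (hG : ∀ l a, G l a k = l)
    (hbody : ∀ γ l a, RunLE (body γ) (Function.update (G (γ :: l) a) k l) (G l (f a γ)) t)
    (l : List (Γ k)) (a : X) :
    RunLE (.each k body) (G l a) (G [] (l.foldl f a)) (l.length * (t + 1) + 1) := by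
  induction l generalizing a with
  | nil => exact ⟨1, by simp, .each_nil (hG _ _)⟩
  | cons γ l ih =>
    obtain ⟨s, hs, hr⟩ := hbody γ l a
    obtain ⟨s', hs', hr'⟩ := ih (f a γ)
    refine ⟨_, ?_, .each_cons (hG _ _) hr hr'⟩
    simp only [List.length_cons, Nat.add_mul, Nat.one_mul]
    omega

/-- `p` leads from `S w` to `S' w` in time polynomial in the length of `w`. -/
def PolyRun {A : Type} (p : Prog Γ) (S S' : List A → ∀ k, List (Γ k)) : Prop :=
  ∃ q : Polynomial ℕ, ∀ w, RunLE p (S w) (S' w) (q.eval w.length)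

theorem PolyRun.seq {A : Type} {p q : Prog Γ} {S S' S'' : List A → ∀ k, List (Γ k)}
    (h₁ : PolyRun p S S') (h₂ : PolyRun q S' S'') : PolyRun (.seq p q) S S'' :=
  let ⟨r₁, hr₁⟩ := h₁
  let ⟨r₂, hr₂⟩ := h₂
  ⟨r₁ + r₂, fun w => by rw [Polynomial.eval_add]; exact (hr₁ w).seq (hr₂ w)⟩

end Time

/-! ### A program that writes an indexed sequence of blocks -/

/-- The stacks of the program. -/
inductive Stk
  | inp | rev | cel | out | x | y | u | v
  deriving DecidableEq

instance : Fintype Stk :=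
  ⟨{.inp, .rev, .cel, .out, .x, .y, .u, .v}, fun k => by cases k <;> simp⟩

variable {A B Tok : Type}

/-- The alphabets of the stacks. -/
@[reducible] def Alph (A B Tok : Type) : Stk → Type
  | .inp => A
  | .rev => A
  | .cel => B
  | .out => Tok
  | .x => Unit
  | .y => Unit
  | .u => Unit
  | .v => Unit

instance [Finite A] [Finite B] [Finite Tok] : ∀ k, Finite (Alph A B Tok k)
  | .inp => inferInstanceAs (Finite A)
  | .rev => inferInstanceAs (Finite A)
  | .cel => inferInstanceAs (Finite B)
  | .out => inferInstanceAs (Finite Tok)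
  | .x => inferInstanceAs (Finite Unit)
  | .y => inferInstanceAs (Finite Unit)
  | .u => inferInstanceAs (Finite Unit)
  | .v => inferInstanceAs (Finite Unit)

/-- The stacks with the given contents; the last four stacks are unary counters. -/
def contents (inp rev : List A) (cel : List B) (out : List Tok) (x y u v : ℕ) :
    ∀ k, List (Alph A B Tok k)
  | .inp => inp
  | .rev => rev
  | .cel => cel
  | .out => out
  | .x => List.replicate x ()
  | .y => List.replicate y ()
  | .u => List.replicate u ()
  | .v => List.replicate v ()

section Update

variable (inp rev : List A) (cel : List B) (out : List Tok) (x y u v : ℕ)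

theorem update_inp (l : List A) : Function.update (contents inp rev cel out x y u v) Stk.inp l =
    contents l rev cel out x y u v := by
  funext k; cases k <;> rfl

theorem update_rev (l : List A) : Function.update (contents inp rev cel out x y u v) Stk.rev l =
    contents inp l cel out x y u v := by
  funext k; cases k <;> rfl

theorem update_cel (l : List B) : Function.update (contents inp rev cel out x y u v) Stk.cel l =
    contents inp rev l out x y u v := by
  funext k; cases k <;> rfl

theorem update_out (l : List Tok) : Function.update (contents inp rev cel out x y u v) Stk.out l =
    contents inp rev cel l x y u v := by
  funext k; cases k <;> rfl

theorem update_x (m : ℕ) :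
    Function.update (contents inp rev cel out x y u v) Stk.x (List.replicate m ()) =
      contents inp rev cel out m y u v := by
  funext k; cases k <;> rfl

theorem update_y (m : ℕ) :
    Function.update (contents inp rev cel out x y u v) Stk.y (List.replicate m ()) =
      contents inp rev cel out x m u v := by
  funext k; cases k <;> rfl

theorem update_u (m : ℕ) :
    Function.update (contents inp rev cel out x y u v) Stk.u (List.replicate m ()) =
      contents inp rev cel out x y m v := by
  funext k; cases k <;> rfl

theorem update_v (m : ℕ) :
    Function.update (contents inp rev cel out x y u v) Stk.v (List.replicate m ()) =
      contents inp rev cel out x y u m := by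
  funext k; cases k <;> rfl

theorem push_rev (a : A) : RunLE (.push Stk.rev a) (contents inp rev cel out x y u v)
    (contents inp (a :: rev) cel out x y u v) 1 :=
  .push (update_rev ..)

theorem push_cel (b : B) : RunLE (.push Stk.cel b) (contents inp rev cel out x y u v)
    (contents inp rev (b :: cel) out x y u v) 1 :=
  .push (update_cel ..)

theorem push_out (a : Tok) : RunLE (.push Stk.out a) (contents inp rev cel out x y u v)
    (contents inp rev cel (a :: out) x y u v) 1 :=
  .push (update_out ..)

theorem push_x : RunLE (.push Stk.x ()) (contents inp rev cel out x y u v)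
    (contents inp rev cel out (x + 1) y u v) 1 :=
  .push (update_x inp rev cel out x y u v (x + 1))

theorem push_y : RunLE (.push Stk.y ()) (contents inp rev cel out x y u v)
    (contents inp rev cel out x (y + 1) u v) 1 :=
  .push (update_y inp rev cel out x y u v (y + 1))

theorem push_u : RunLE (.push Stk.u ()) (contents inp rev cel out x y u v)
    (contents inp rev cel out x y (u + 1) v) 1 :=
  .push (update_u inp rev cel out x y u v (u + 1))

theorem push_v : RunLE (.push Stk.v ()) (contents inp rev cel out x y u v)
    (contents inp rev cel out x y u (v + 1)) 1 :=
  .push (update_v inp rev cel out x y u v (v + 1))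

end Update

/-! ### Loops over counters, cells and output -/

section Loops

variable {X : Type}

/-- A loop over a unary counter: `G m a` are the stacks when the counter is `m` and the loop has
computed `a`. -/
theorem each_counter {k : Stk} {body : Alph A B Tok k → Prog (Alph A B Tok)} (γ : Alph A B Tok k)
    (G : ℕ → X → ∀ k, List (Alph A B Tok k)) (f : X → X) (t : ℕ)
    (hG : ∀ m a, G m a k = List.replicate m γ)
    (hupd : ∀ m a, Function.update (G (m + 1) a) k (List.replicate m γ) = G m a)
    (hbody : ∀ m a, RunLE (body γ) (G m a) (G m (f a)) t) (m : ℕ) (a : X) :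
    RunLE (.each k body) (G m a) (G 0 (f^[m] a)) (m * (t + 1) + 1) := by
  induction m generalizing a with
  | zero => exact ⟨1, by simp, .each_nil (hG _ _)⟩
  | succ m ih =>
    obtain ⟨s, hs, hr⟩ := hbody m a
    obtain ⟨s', hs', hr'⟩ := ih (f a)
    refine ⟨_, ?_, .each_cons ((hG _ _).trans List.replicate_succ) (by rw [hupd]; exact hr) hr'⟩
    simp only [Nat.add_mul, Nat.one_mul]
    omega

variable (inp rev : List A) (cel : List B) (out : List Tok) (x y u v : ℕ)

/-- Multiply the counter `v := v + u * x`, emptying `u`. -/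
def mulLoop : Prog (Alph A B Tok) :=
  .each Stk.u fun _ =>
    -- The factor `x` is moved to `y` and back, so that it survives each round.
    .seq (.each Stk.x fun _ => .seq (.push Stk.y ()) (.push Stk.v ()))
      (.each Stk.y fun _ => .push Stk.x ())

theorem iterate_add_pair (m : ℕ) (i j : ℕ) (a : ℕ × ℕ) :
    (fun a : ℕ × ℕ => (a.1 + i, a.2 + j))^[m] a = (a.1 + m * i, a.2 + m * j) := by
  induction m generalizing a with
  | zero => simp
  | succ m ih => rw [Function.iterate_succ_apply, ih]; ext <;> simp <;> ring

theorem iterate_add (m : ℕ) (i a : ℕ) : (fun a : ℕ => a + i)^[m] a = a + m * i := by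
  induction m generalizing a with
  | zero => simp
  | succ m ih => rw [Function.iterate_succ_apply, ih]; ring

theorem run_mulLoop : RunLE mulLoop (contents inp rev cel out x 0 u v)
    (contents inp rev cel out x 0 0 (v + u * x)) (u * (5 * x + 3) + 1) := by
  have h₁ : ∀ u v, RunLE (.each Stk.x fun _ => .seq (.push Stk.y ()) (.push Stk.v ()))
      (contents inp rev cel out x 0 u v) (contents inp rev cel out 0 x u (v + x))
      (x * 3 + 1) := fun u v => by
    have := each_counter (k := Stk.x) (body := fun _ => .seq (.push Stk.y ()) (.push Stk.v ())) ()
      (fun m (a : ℕ × ℕ) => contents inp rev cel out m a.1 u a.2) (fun a => (a.1 + 1, a.2 + 1)) 2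
      (fun m a => rfl) (fun m a => update_x ..)
      (fun m a => (push_y ..).seq (push_v ..)) x (0, v)
    simpa [iterate_add_pair] using this
  have h₂ : ∀ u v, RunLE (.each Stk.y fun _ => .push Stk.x ())
      (contents inp rev cel out 0 x u v) (contents inp rev cel out x 0 u v)
      (x * 2 + 1) := fun u v => by
    have := each_counter (k := Stk.y) (body := fun _ => .push Stk.x ()) ()
      (fun m a => contents inp rev cel out a m u v) (fun a => a + 1) 1
      (fun m a => rfl) (fun m a => update_y ..) (fun m a => push_x ..) x 0
    simpa [iterate_add] using this
  have := each_counter (k := Stk.u) (body := fun _ => .seq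
      (.each Stk.x fun _ => .seq (.push Stk.y ()) (.push Stk.v ()))
      (.each Stk.y fun _ => .push Stk.x ())) ()
      (fun m a => contents inp rev cel out x 0 m a) (fun a => a + x) (x * 3 + 1 + (x * 2 + 1))
      (fun m a => rfl) (fun m a => update_u ..)
      (fun m a => (h₁ ..).seq (h₂ ..)) u v
  refine RunLE.mono (by simpa [iterate_add, mulLoop] using this) (le_of_eq (by ring))

/-- Move the counter `v` to `u`. -/
def moveLoop : Prog (Alph A B Tok) := .each Stk.v fun _ => .push Stk.u ()

theorem run_moveLoop : RunLE moveLoop (contents inp rev cel out x y u v)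
    (contents inp rev cel out x y (u + v) 0) (v * 2 + 1) := by
  have := each_counter (k := Stk.v) (body := fun _ => .push Stk.u ()) ()
    (fun m a => contents inp rev cel out x y a m) (fun a => a + 1) 1
    (fun m a => rfl) (fun m a => update_v ..) (fun m a => push_u ..) v u
  simpa [iterate_add, moveLoop] using this

/-- Push `c` units on `u`. -/
def pushUnits : ℕ → Prog (Alph A B Tok)
  | 0 => .skip
  | c + 1 => .seq (pushUnits c) (.push Stk.u ())

theorem run_pushUnits (c : ℕ) : RunLE (pushUnits c) (contents inp rev cel out x y u v)
    (contents inp rev cel out x y (u + c) v) (c + 1) := by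
  induction c with
  | zero => exact .skip _
  | succ c ih => exact ih.seq (push_u ..)

/-- `u := u * x ^ d`. -/
def powLoop : ℕ → Prog (Alph A B Tok)
  | 0 => .skip
  | d + 1 => .seq (powLoop d) (.seq mulLoop moveLoop)

-- Each of the `d` rounds is polynomial because the value reached by `u` is itself polynomial in the
-- input length.
open Polynomial in
theorem run_powLoop (S : List A → List A) (rev : List A → List A) (c d : ℕ) :
    PolyRun (powLoop d)
      (fun w => contents (S w) (rev w) cel out (w.length + 1) 0 c 0)
      (fun w => contents (S w) (rev w) cel out (w.length + 1) 0 (c * (w.length + 1) ^ d) 0) := by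
  induction d with
  | zero => exact ⟨1, fun w => by simpa [powLoop] using RunLE.skip _⟩
  | succ d ih =>
    refine ih.seq ⟨C c * (X + 1) ^ d * (5 * (X + 1) + 3) + 1
      + (C c * (X + 1) ^ (d + 1) * 2 + 1), fun w => ?_⟩
    have h₁ := run_mulLoop (S w) (rev w) cel out (w.length + 1) (c * (w.length + 1) ^ d) 0
    have h₂ := run_moveLoop (S w) (rev w) cel out (w.length + 1) 0 0
      (0 + c * (w.length + 1) ^ d * (w.length + 1))
    convert h₁.seq h₂ using 1
    · simp [pow_succ, mul_assoc]
    · simp [pow_succ, mul_assoc]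

/-- Push a cell for each unit of `u`, moving `u` to `v`. -/
def padLoop (b : B) : Prog (Alph A B Tok) :=
  .each Stk.u fun _ => .seq (.push Stk.v ()) (.push Stk.cel b)

theorem iterate_cons {α : Type} (m : ℕ) (b : α) (i : ℕ) (l : List α) :
    (fun a : ℕ × List α => (a.1 + 1, b :: a.2))^[m] (i, l) = (i + m, List.replicate m b ++ l) := by
  induction m generalizing i l with
  | zero => simp
  | succ m ih =>
    rw [Function.iterate_succ_apply, ih, List.replicate_succ']
    ext <;> simp; ring

theorem run_padLoop (b : B) : RunLE (padLoop b) (contents inp rev cel out x y u v)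
    (contents inp rev (List.replicate u b ++ cel) out x y 0 (v + u)) (u * 3 + 1) := by
  have := each_counter (k := Stk.u) (body := fun _ => .seq (.push Stk.v ()) (.push Stk.cel b)) ()
    (fun m (a : ℕ × List B) => contents inp rev a.2 out x y m a.1) (fun a => (a.1 + 1, b :: a.2)) 2
    (fun m a => rfl) (fun m a => update_u ..)
    (fun m a => (push_v ..).seq (push_cel ..)) u (v, cel)
  simpa [iterate_cons, padLoop] using this

/-- Push a cell for each unit of `v`. -/
def padLoop' (b : B) : Prog (Alph A B Tok) := .each Stk.v fun _ => .push Stk.cel b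

theorem run_padLoop' (b : B) : RunLE (padLoop' b) (contents inp rev cel out x y u v)
    (contents inp rev (List.replicate v b ++ cel) out x y u 0) (v * 2 + 1) := by
  have := each_counter (k := Stk.v) (body := fun _ => .push Stk.cel b) ()
    (fun m (a : ℕ × List B) => contents inp rev a.2 out x y u m) (fun a => (a.1 + 1, b :: a.2)) 1
    (fun m a => rfl) (fun m a => update_v ..)
    (fun m a => push_cel ..) v (0, cel)
  simpa [iterate_cons, padLoop'] using this

/-- Empty `x`. -/
def clearLoop : Prog (Alph A B Tok) := .each Stk.x fun _ => .skip

theorem run_clearLoop : RunLE clearLoop (contents inp rev cel out x y u v)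
    (contents inp rev cel out 0 y u v) (x * 2 + 1) := by
  have := each_counter (k := Stk.x) (body := fun _ => .skip) ()
    (fun m (_ : Unit) => contents inp rev cel out m y u v) (fun a => a) 1
    (fun m a => rfl) (fun m a => update_x ..) (fun m a => RunLE.skip _) x ()
  simpa [clearLoop] using this

/-- Reverse the input, counting its length. -/
def readLoop : Prog (Alph A B Tok) :=
  .each Stk.inp fun a => .seq (.push Stk.rev a) (.push Stk.x ())

theorem run_readLoop : RunLE readLoop (contents inp rev cel out x y u v)
    (contents [] (inp.reverse ++ rev) cel out (x + inp.length) y u v) (inp.length * 3 + 1) := by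
  have := RunLE.each (Γ := Alph A B Tok) (k := Stk.inp)
    (body := fun a => .seq (.push Stk.rev a) (.push Stk.x ()))
    (fun l (a : ℕ × List A) => contents l a.2 cel out a.1 y u v) (fun a γ => (a.1 + 1, γ :: a.2)) 2
    (fun m a => rfl) (fun γ l a => by
      exact (update_inp ..).symm ▸ (push_rev ..).seq (push_x ..)) inp (x, rev)
  have hf : ∀ (l : List A) (a : ℕ × List A), l.foldl (fun a γ => (a.1 + 1, γ :: a.2)) a =
      (a.1 + l.length, l.reverse ++ a.2) := by
    intro l
    induction l with
    | nil => simp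
    | cons γ l ih => intro a; simp [ih]; omega
  rw [hf] at this
  exact this

/-- Write the input letters as cells. -/
def letterLoop (f : A → B) : Prog (Alph A B Tok) := .each Stk.rev fun a => .push Stk.cel (f a)

theorem run_letterLoop (f : A → B) : RunLE (letterLoop f) (contents inp rev cel out x y u v)
    (contents inp [] (rev.reverse.map f ++ cel) out x y u v) (rev.length * 2 + 1) := by
  have := RunLE.each (Γ := Alph A B Tok) (k := Stk.rev) (body := fun a => .push Stk.cel (f a))
    (fun l (a : List B) => contents inp l a out x y u v) (fun a γ => f γ :: a) 1
    (fun m a => rfl) (fun γ l a => by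
      exact (update_rev ..).symm ▸ push_cel ..) rev cel
  have hf : ∀ (l : List A) (a : List B), l.foldl (fun a γ => f γ :: a) a =
      l.reverse.map f ++ a := by
    intro l
    induction l with
    | nil => simp
    | cons γ l ih => intro a; simp [ih]
  rw [hf] at this
  exact this

/-- Apply `f` to the first cell. -/
def markTop (f : B → B) : Prog (Alph A B Tok) := .pop Stk.cel fun b => .push Stk.cel (f b)

theorem run_markTop (f : B → B) (b : B) : RunLE (markTop f) (contents inp rev (b :: cel) out x y u v)
    (contents inp rev (f b :: cel) out x y u v) 2 :=
  RunLE.pop (Γ := Alph A B Tok) (k := Stk.cel) (γ := b) (l := cel) (t := 1)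
    (body := fun b => .push Stk.cel (f b)) rfl ((update_cel ..).symm ▸ push_cel ..)

/-- Push the symbols of `l` on the output stack, the last one first. -/
def pushOut : List Tok → Prog (Alph A B Tok)
  | [] => .skip
  | a :: l => .seq (pushOut l) (.push Stk.out a)

theorem run_pushOut (l : List Tok) : RunLE (pushOut l) (contents inp rev cel out x y u v)
    (contents inp rev cel (l ++ out) x y u v) (l.length + 1) := by
  induction l with
  | nil => exact .skip _
  | cons a l ih => exact ih.seq (push_out ..)

/-- Instantiate a template: `none` stands for `C * k` copies of `tick`. -/
def expand (C : ℕ) (tick : Tok) (k : ℕ) (T : List (Option Tok)) : List Tok :=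
  T.flatMap fun o => o.elim (List.replicate (C * k) tick) fun a => [a]

/-- Push `C * x` copies of `tick` on the output stack. -/
def ticks (C : ℕ) (tick : Tok) : Prog (Alph A B Tok) :=
  .seq (.each Stk.x fun _ => .seq (.push Stk.y ()) (pushOut (List.replicate C tick)))
    (.each Stk.y fun _ => .push Stk.x ())

theorem run_ticks (C : ℕ) (tick : Tok) : RunLE (ticks C tick)
    (contents inp rev cel out x 0 u v)
    (contents inp rev cel (List.replicate (C * x) tick ++ out) x 0 u v)
    (x * (C + 5) + 2) := by
  have h₁ : RunLE (.each Stk.x fun _ => .seq (.push Stk.y ()) (pushOut (List.replicate C tick)))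
      (contents inp rev cel out x 0 u v)
      (contents inp rev cel (List.replicate (C * x) tick ++ out) 0 x u v)
      (x * (1 + (C + 1) + 1) + 1) := by
    have := each_counter (k := Stk.x)
      (body := fun _ => .seq (.push Stk.y ()) (pushOut (List.replicate C tick))) ()
      (fun m (a : ℕ × List Tok) => contents inp rev cel a.2 m a.1 u v)
      (fun a => (a.1 + 1, List.replicate C tick ++ a.2)) (1 + (C + 1))
      (fun m a => rfl) (fun m a => update_x ..)
      (fun m a => (push_y ..).seq (by simpa using run_pushOut (l := List.replicate C tick) ..))
      x (0, out)
    have hf : ∀ (m i : ℕ) (l : List Tok),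
        (fun a : ℕ × List Tok => (a.1 + 1, List.replicate C tick ++ a.2))^[m] (i, l) =
          (i + m, List.replicate (C * m) tick ++ l) := by
      intro m
      induction m with
      | zero => simp
      | succ m ih =>
        intro i l
        rw [Function.iterate_succ_apply, ih, ← List.append_assoc, List.replicate_append_replicate]
        ext <;> simp [Nat.mul_succ]; ring
    simpa [hf] using this
  have h₂ : RunLE (.each Stk.y fun _ => .push Stk.x ())
      (contents inp rev cel (List.replicate (C * x) tick ++ out) 0 x u v)
      (contents inp rev cel (List.replicate (C * x) tick ++ out) x 0 u v) (x * 2 + 1) := by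
    have := each_counter (k := Stk.y) (body := fun _ => .push Stk.x ()) ()
      (fun m a => contents inp rev cel (List.replicate (C * x) tick ++ out) a m u v)
      (fun a => a + 1) 1
      (fun m a => rfl) (fun m a => update_y ..) (fun m a => push_x ..) x 0
    simpa [iterate_add] using this
  exact (h₁.seq h₂).mono (le_of_eq (by ring))

/-- Write the instance of a template. -/
def emit (C : ℕ) (tick : Tok) : List (Option Tok) → Prog (Alph A B Tok)
  | [] => .skip
  | none :: T => .seq (emit C tick T) (ticks C tick)
  | some a :: T => .seq (emit C tick T) (.push Stk.out a)

theorem run_emit (C : ℕ) (tick : Tok) (T : List (Option Tok)) : RunLE (emit C tick T)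
    (contents inp rev cel out x 0 u v)
    (contents inp rev cel (expand C tick x T ++ out) x 0 u v)
    (T.length * (x * (C + 5) + 2) + 1) := by
  induction T with
  | nil => exact (RunLE.skip _).mono (by simp)
  | cons o T ih =>
    cases o with
    | none =>
      have := ih.seq (run_ticks inp rev cel (expand C tick x T ++ out) x u v C tick)
      rw [← List.append_assoc] at this
      exact this.mono (by simp only [List.length_cons]; linarith)
    | some a =>
      have := ih.seq (push_out inp rev cel (expand C tick x T ++ out) x 0 u v a)
      exact this.mono (by simp only [List.length_cons]; nlinarith)

/-- Write the blocks of all cells; the cell at position `k` of the list is written with index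
`k`. -/
def emitLoop (C : ℕ) (tick : Tok) (T : B → List (Option Tok)) : Prog (Alph A B Tok) :=
  .each Stk.cel fun b => .seq (emit C tick (T b)) (.push Stk.x ())

/-- The output of `emitLoop`. -/
def blocks (C : ℕ) (tick : Tok) (T : B → List (Option Tok)) : ℕ → List B → List Tok
  | _, [] => []
  | k, b :: cel => blocks C tick T (k + 1) cel ++ expand C tick k (T b)

/-- The cost of a round grows with the index `x`; the bound `N` on all indices makes it uniform.
Later blocks are pushed on top of earlier ones, hence the reversed order in `blocks`. -/
theorem run_emitLoop (C : ℕ) (tick : Tok) (T : B → List (Option Tok)) (m N : ℕ)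
    (hT : ∀ b, (T b).length ≤ m) (cel : List B) (hN : x + cel.length ≤ N) (out : List Tok) :
    RunLE (emitLoop C tick T) (contents inp rev cel out x 0 u v)
      (contents inp rev [] (blocks C tick T x cel ++ out) (x + cel.length) 0 u v)
      (cel.length * (m * (N * (C + 5) + 2) + 3) + 1) := by
  induction cel generalizing x out with
  | nil => exact ⟨1, by simp, .each_nil rfl⟩
  | cons b cel ih =>
    rw [List.length_cons] at hN
    obtain ⟨s, hs, hr⟩ := (run_emit inp rev cel out x u v C tick (T b)).seq (push_x ..)
    obtain ⟨s', hs', hr'⟩ := ih (x + 1) (by omega) (expand C tick x (T b) ++ out)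
    have hb : (T b).length * (x * (C + 5) + 2) ≤ m * (N * (C + 5) + 2) := by
      have : x ≤ N := by omega
      gcongr
      exact hT b
    refine ⟨1 + s + s', ?_, .each_cons (γ := b) (l := cel) rfl
      (by exact (update_cel ..).symm ▸ hr) ?_⟩
    · rw [List.length_cons, Nat.add_mul, Nat.one_mul]
      omega
    · have e : x + (b :: cel).length = x + 1 + cel.length := by rw [List.length_cons]; ring
      rw [e, blocks, List.append_assoc]
      exact hr'

end Loops

/-! ### The complete output program -/

section Main

variable (f : A → B) (blank border : B) (mark : B → B) (c d C : ℕ) (tick : Tok)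
  (T : B → List (Option Tok)) (post : List Tok)

/-- The cells for the word `w`: a border cell, `c * (|w| + 1) ^ d` blanks, the letters of `w`,
blanks and a border cell; the first cell after the first blanks is marked. -/
def cells (w : List A) : List B :=
  border :: (List.replicate (c * (w.length + 1) ^ d) blank ++
    (w.map f ++ (List.replicate (c * (w.length + 1) ^ d) blank ++ [blank, border])).modifyHead mark)

/-- The program that writes the blocks of the cells of the input word. -/
def blockProg : Prog (Alph A B Tok) :=
  .seq (.seq readLoop (.push Stk.x ()))
  (.seq (pushUnits c)
  (.seq (powLoop d)
  (.seq (.seq clearLoop (.seq (.push Stk.cel border) (.push Stk.cel blank)))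
  (.seq (padLoop blank)
  (.seq (.seq (letterLoop f) (markTop mark))
  (.seq (.seq (padLoop' blank) (.push Stk.cel border))
  (.seq (pushOut post)
  (.seq (emitLoop C tick T) clearLoop))))))))

-- A stack is filled from its bottom, so the cells are built from right to left: border and extra
-- blank, right padding, letters, left padding, border. The padding length is computed once; writing
-- the right padding moves it to `v`, from where the left padding consumes it. The start cell is
-- marked while it is on top, just before the left padding.
open Polynomial in
theorem polyRun_blockProg [Finite B] :
    PolyRun (blockProg f blank border mark c d C tick T post)
      (fun w => Function.update (fun _ => []) Stk.inp w)
      (fun w => Function.update (fun _ => []) Stk.out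
        (blocks C tick T 0 (cells f blank border mark c d w) ++ post)) := by
  obtain ⟨m, hm⟩ : ∃ m, ∀ b, (T b).length ≤ m := by
    obtain ⟨m, hm⟩ := (Set.finite_range fun b => (T b).length).bddAbove
    exact ⟨m, fun b => hm ⟨b, rfl⟩⟩
  have hinit : ∀ w, Function.update (fun k => ([] : List (Alph A B Tok k))) Stk.inp w =
      contents w [] [] [] 0 0 0 0 := fun w => by funext k; cases k <;> rfl
  have hfin : ∀ w, Function.update (fun k => ([] : List (Alph A B Tok k))) Stk.out w =
      contents [] [] [] w 0 0 0 0 := fun w => by funext k; cases k <;> rfl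
  simp only [hinit, hfin]
  set P : List A → ℕ := fun w => c * (w.length + 1) ^ d with hP
  have hPe : ∀ w, (Polynomial.C c * (X + 1) ^ d).eval w.length = P w := fun w => by simp [hP]
  refine PolyRun.seq (S' := fun w => contents [] w.reverse [] [] (w.length + 1) 0 0 0)
    ⟨X * 3 + 1 + 1, fun w => ?_⟩ ?_
  · simpa using (run_readLoop w [] [] [] 0 0 0 0).seq (push_x ..)
  refine PolyRun.seq (S' := fun w => contents [] w.reverse [] [] (w.length + 1) 0 c 0)
    ⟨Polynomial.C c + 1, fun w => ?_⟩ ?_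
  · simpa using run_pushUnits [] w.reverse [] [] (w.length + 1) 0 0 0 c
  refine PolyRun.seq (S' := fun w => contents [] w.reverse [] [] (w.length + 1) 0 (P w) 0)
    (run_powLoop _ _ (fun _ => []) List.reverse c d) ?_
  refine PolyRun.seq (S' := fun w => contents [] w.reverse [blank, border] [] 0 0 (P w) 0)
    ⟨(X + 1) * 2 + 1 + 2, fun w => ?_⟩ ?_
  · simpa using (run_clearLoop [] w.reverse [] [] (w.length + 1) 0 (P w) 0).seq
      ((push_cel ..).seq (push_cel ..))
  refine PolyRun.seq (S' := fun w => contents [] w.reverse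
      (List.replicate (P w) blank ++ [blank, border]) [] 0 0 0 (P w))
    ⟨(Polynomial.C c * (X + 1) ^ d) * 3 + 1, fun w => ?_⟩ ?_
  · rw [eval_add, eval_mul, hPe]
    simpa using run_padLoop [] w.reverse [blank, border] [] 0 0 (P w) 0 blank
  refine PolyRun.seq (S' := fun w => contents [] []
      ((w.map f ++ (List.replicate (P w) blank ++ [blank, border])).modifyHead mark)
      [] 0 0 0 (P w)) ⟨X * 2 + 1 + 2, fun w => ?_⟩ ?_
  · have h := run_letterLoop (Tok := Tok) [] w.reverse
      (List.replicate (P w) blank ++ [blank, border]) [] 0 0 0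
      (P w) f
    rw [List.reverse_reverse] at h
    -- The extra blank guarantees a cell to mark even if the word and the padding are empty.
    obtain ⟨b, l, hb⟩ : ∃ b l, w.map f ++ (List.replicate (P w) blank ++ [blank, border]) =
        b :: l := List.exists_cons_of_ne_nil (by simp)
    beta_reduce
    rw [hb] at h ⊢
    simpa using h.seq (run_markTop ..)
  refine PolyRun.seq (S' := fun w => contents [] [] (cells f blank border mark c d w)
      [] 0 0 0 0) ⟨(Polynomial.C c * (X + 1) ^ d) * 2 + 1 + 1, fun w => ?_⟩ ?_
  · rw [eval_add, eval_add, eval_mul, hPe]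
    simpa [cells] using (run_padLoop' [] [] _ [] 0 0 0 (P w) blank).seq (push_cel ..)
  refine PolyRun.seq (S' := fun w => contents [] [] (cells f blank border mark c d w)
      post 0 0 0 0) ⟨Polynomial.C (post.length + 1), fun w => ?_⟩ ?_
  · simpa using run_pushOut [] [] (cells f blank border mark c d w) [] 0 0 0 0 post
  have hlen : ∀ w, (cells f blank border mark c d w).length =
      ((Polynomial.C c * (X + 1) ^ d) * 2 + X + 3).eval w.length := fun w => by
    rw [eval_add, eval_add, eval_mul, hPe]
    simp [cells]
    ring
  refine PolyRun.seq (S' := fun w => contents [] [] []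
      (blocks C tick T 0 (cells f blank border mark c d w) ++ post)
      (cells f blank border mark c d w).length 0 0 0)
    ⟨((Polynomial.C c * (X + 1) ^ d) * 2 + X + 3) *
      (Polynomial.C m * (((Polynomial.C c * (X + 1) ^ d) * 2 + X + 3) *
        Polynomial.C (C + 5) + 2) + 3) + 1, fun w => ?_⟩
    ⟨((Polynomial.C c * (X + 1) ^ d) * 2 + X + 3) * 2 + 1, fun w => ?_⟩
  · have := run_emitLoop (A := A) [] [] 0 0 0 C tick T m _ hm (cells f blank border mark c d w)
      le_rfl post
    rw [Nat.zero_add] at this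
    convert this using 1
    rw [hlen]
    simp
  · have := run_clearLoop (A := A) [] [] ([] : List B)
      (blocks C tick T 0 (cells f blank border mark c d w) ++ post)
      (cells f blank border mark c d w).length 0 0 0
    convert this using 1
    rw [hlen]
    simp

end Main

end StackProg

namespace HS

/-! ### Renaming variables, and conjunctions -/

/-- Rename the variables of a literal. -/
def Literal.rename (g : ℕ → ℕ) : Literal → Literal
  | .top => .top
  | .bot => .bot
  | .var p => .var (g p)
  | .dia R l => .dia R (l.rename g)
  | .box R l => .box R (l.rename g)

/-- Rename the variables of a formula. -/
def CoreFormula.rename (g : ℕ → ℕ) : CoreFormula → CoreFormula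
  | .init l => .init (l.rename g)
  | .imp l₁ l₂ => .imp (l₁.rename g) (l₂.rename g)
  | .disj l₁ l₂ => .disj (l₁.rename g) (l₂.rename g)
  | .and φ ψ => .and (φ.rename g) (ψ.rename g)

section Rename

variable {T : Type*} [LinearOrder T] (sem : IntervalRel → Semantics)
  (ν : ℕ → Set (NonemptyInterval T)) (g : ℕ → ℕ)

theorem Literal.holds_rename (l : Literal) (I : NonemptyInterval T) :
    (l.rename g).Holds sem ν I ↔ l.Holds sem (fun p => ν (g p)) I := by
  induction l generalizing I with
  | top => rfl
  | bot => rfl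
  | var p => rfl
  | dia R l ih => simp only [rename, Holds, ih]
  | box R l ih => simp only [rename, Holds, ih]

theorem CoreFormula.holds_rename (φ : CoreFormula) (I : NonemptyInterval T) :
    (φ.rename g).Holds sem ν I ↔ φ.Holds sem (fun p => ν (g p)) I := by
  induction φ with
  | init l => exact l.holds_rename sem ν g I
  | imp l₁ l₂ => simp only [rename, Holds, Literal.holds_rename]
  | disj l₁ l₂ => simp only [rename, Holds, Literal.holds_rename]
  | and φ ψ ih₁ ih₂ => simp only [rename, Holds, ih₁, ih₂]

/-- The conjunction of a list of formulas, ending with `φ`. -/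
def conj (L : List CoreFormula) (φ : CoreFormula) : CoreFormula := L.foldr .and φ

theorem holds_conj (L : List CoreFormula) (φ : CoreFormula) (I : NonemptyInterval T) :
    (conj L φ).Holds sem ν I ↔ (∀ ψ ∈ L, ψ.Holds sem ν I) ∧ φ.Holds sem ν I := by
  induction L with
  | nil => simp [conj]
  | cons ψ L ih => simp [conj, CoreFormula.Holds] at ih ⊢; simp [ih, and_assoc]

end Rename

theorem encode_conj (L : List CoreFormula) (φ : CoreFormula) :
    (conj L φ).encode = (L.flatMap fun ψ => .and :: ψ.encode) ++ φ.encode := by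
  induction L with
  | nil => rfl
  | cons ψ L ih => simpa [conj, CoreFormula.encode] using ih

/-! ### Templates -/

/-- Shift the variables from `G` on by `C * k`. -/
def shift (G C k p : ℕ) : ℕ := if G ≤ p then C * k + p else p

/-- The template of a literal. -/
def Literal.template (G : ℕ) : Literal → List (Option Token)
  | .top => [some .top]
  | .bot => [some .bot]
  | .var p => (if G ≤ p then [none] else []) ++ (List.replicate p Token.tick ++ [Token.var]).map some
  | .dia R l => some (.dia R) :: l.template G
  | .box R l => some (.box R) :: l.template G

/-- The template of a formula. -/
def CoreFormula.template (G : ℕ) : CoreFormula → List (Option Token)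
  | .init l => some .init :: l.template G
  | .imp l₁ l₂ => some .imp :: (l₁.template G ++ l₂.template G)
  | .disj l₁ l₂ => some .disj :: (l₁.template G ++ l₂.template G)
  | .and φ ψ => some .and :: (φ.template G ++ ψ.template G)

section Template

open StackProg

variable (G C k : ℕ)

theorem expand_append {Tok : Type} (t : Tok) (T T' : List (Option Tok)) :
    expand C t k (T ++ T') = expand C t k T ++ expand C t k T' := List.flatMap_append

theorem expand_cons_some {Tok : Type} (t a : Tok) (T : List (Option Tok)) :
    expand C t k (some a :: T) = a :: expand C t k T := rfl

theorem expand_map_some {Tok : Type} (t : Tok) (l : List Tok) :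
    expand C t k (l.map some) = l := by
  induction l with
  | nil => rfl
  | cons a l ih => rw [List.map_cons, expand_cons_some, ih]

theorem Literal.expand_template (l : Literal) :
    expand C .tick k (l.template G) = (l.rename (shift G C k)).encode := by
  induction l with
  | top => rfl
  | bot => rfl
  | var p =>
    rw [template, expand_append, expand_map_some, rename, encode, shift, ← List.append_assoc]
    congr 1
    split_ifs
    · simp [expand, List.replicate_append_replicate]
    · rfl
  | dia R l ih => rw [template, expand_cons_some, ih]; rfl
  | box R l ih => rw [template, expand_cons_some, ih]; rfl

theorem CoreFormula.expand_template (φ : CoreFormula) :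
    expand C .tick k (φ.template G) = (φ.rename (shift G C k)).encode := by
  induction φ with
  | init l => rw [template, expand_cons_some, l.expand_template]; rfl
  | imp l₁ l₂ =>
    rw [template, expand_cons_some, expand_append, l₁.expand_template, l₂.expand_template]; rfl
  | disj l₁ l₂ =>
    rw [template, expand_cons_some, expand_append, l₁.expand_template, l₂.expand_template]; rfl
  | and φ ψ ih₁ ih₂ => rw [template, expand_cons_some, expand_append, ih₁, ih₂]; rfl

variable {B : Type} (F : B → List CoreFormula)

/-- The instances of the formulas `F b` for the cells `b` of a list. -/
def instances : ℕ → List B → List CoreFormula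
  | _, [] => []
  | k, b :: cel => instances (k + 1) cel ++ (F b).map (CoreFormula.rename (shift G C k))

/-- The bridge from the words that the program writes to the formulas that they encode. -/
theorem blocks_eq (cel : List B) (k : ℕ) :
    blocks C .tick (fun b => (F b).flatMap fun φ => some .and :: φ.template G) k cel =
      (instances G C F k cel).flatMap fun ψ => .and :: ψ.encode := by
  induction cel generalizing k with
  | nil => rfl
  | cons b cel ih =>
    rw [blocks, instances, ih, List.flatMap_append]
    congr 1
    induction F b with
    | nil => rfl
    | cons φ L ih =>
      rw [List.flatMap_cons, List.cons_append, expand_cons_some, expand_append, ih,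
        φ.expand_template, List.map_cons, List.flatMap_cons, List.cons_append]

theorem forall_mem_instances {P : CoreFormula → Prop} (cel : List B) (k : ℕ) :
    (∀ ψ ∈ instances G C F k cel, P ψ) ↔
      ∀ i b, cel[i]? = some b → ∀ φ ∈ F b, P (φ.rename (shift G C (k + i))) := by
  induction cel generalizing k with
  | nil => simp [instances]
  | cons b cel ih =>
    simp only [instances, List.mem_append, List.mem_map, or_imp, forall_and, ih]
    constructor
    · rintro ⟨h₁, h₂⟩ i b' hb φ hφ
      cases i with
      | zero =>
        obtain rfl : b = b' := by simpa using hb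
        exact h₂ _ ⟨φ, hφ, rfl⟩
      | succ i =>
        have := h₁ i b' (by simpa using hb) φ hφ
        rwa [show k + 1 + i = k + (i + 1) by ring] at this
    · intro h
      refine ⟨fun i b' hb φ hφ => ?_, ?_⟩
      · have := h (i + 1) b' (by simpa using hb) φ hφ
        rwa [show k + (i + 1) = k + 1 + i by ring] at this
      · rintro _ ⟨φ, hφ, rfl⟩
        exact h 0 b (by simp) φ hφ

end Template

end HS

namespace HS

open PolySpace

/-! ### Windows of a Turing machine -/

section Windows

variable {A : Type} (M : Machine A)

instance : Finite M.State := @Finite.of_fintype _ M.stateFin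

instance : Finite M.Sym := @Finite.of_fintype _ M.symFin

/-- The content of a cell: a symbol, with the state if the head scans the cell; or a border. -/
abbrev Cel : Type := Option (M.Sym × Option M.State)

/-- The contents of three neighbouring cells. -/
abbrev Window : Type := Cel M × Cel M × Cel M

/-- The number of windows. -/
noncomputable def numWin : ℕ := Nat.card (Window M)

/-- The enumeration of the windows. -/
noncomputable def win : Fin (numWin M) ≃ Window M := (Finite.equivFin _).symm

variable {M}

/-- The state in which the head leaves a cell, if it moves into a direction with `d`. -/
def leaving (d : Move → Bool) : Cel M → Option M.State
  | some (s, some q) => (M.δ q s).bind fun r => if d r.2.2 then some r.1 else none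
  | _ => none

/-- Move to the right? -/
def isRight : Move → Bool
  | .right => true
  | _ => false

/-- Move to the left? -/
def isLeft : Move → Bool
  | .left => true
  | _ => false

/-- No move? -/
def isStay : Move → Bool
  | .stay => true
  | _ => false

/-- The content of the middle cell of a window after one step; `none` if the head scans this cell
and the machine has halted. -/
def next : Window M → Option (Cel M)
  | (_, none, _) => some none
  | (_, some (s, some q), _) =>
    (M.δ q s).map fun r => some (r.2.1, if isStay r.2.2 then some r.1 else none)
  | (l, some (s, none), r) => some (some (s, (leaving isRight l).or (leaving isLeft r)))

/-- The head does not scan the cell, or the machine has halted and accepts. -/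
def Accepting : Cel M → Prop
  | some (s, some q) => M.δ q s = none ∧ q ∈ M.accept
  | _ => True

open Classical in
/-- The content of the cell `z`; all cells outside `lo, …, hi` are borders. -/
noncomputable def cellAt (lo hi : ℤ) (c : M.Cfg) (z : ℤ) : Cel M :=
  if lo ≤ z ∧ z ≤ hi then some (c.tape z, if z = c.head then some c.state else none) else none

/-- The window around the cell `z`. -/
noncomputable def windowAt (lo hi : ℤ) (c : M.Cfg) (z : ℤ) : Window M :=
  (cellAt lo hi c (z - 1), cellAt lo hi c z, cellAt lo hi c (z + 1))

theorem cellAt_head {lo hi : ℤ} {c : M.Cfg} (h : lo ≤ c.head ∧ c.head ≤ hi) :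
    cellAt lo hi c c.head = some (c.tape c.head, some c.state) := by
  simp [cellAt, h]

theorem leaving_cellAt {lo hi : ℤ} {c : M.Cfg} (h : lo ≤ c.head ∧ c.head ≤ hi) (d : Move → Bool)
    (z : ℤ) : leaving d (cellAt lo hi c z) =
      if z = c.head then (M.δ c.state (c.tape c.head)).bind
        fun r => if d r.2.2 then some r.1 else none else none := by
  unfold cellAt
  by_cases hz : z = c.head
  · subst hz
    simp [h, leaving]
  · by_cases hr : lo ≤ z ∧ z ≤ hi <;> simp [hz, hr, leaving]

/-- A head can only arrive from an adjacent cell, so a window determines the new content of its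
middle. The new head position may lie outside `lo, …, hi`: borders stay borders, and the head is
then invisible on both sides. -/
theorem next_windowAt {lo hi : ℤ} {c c' : M.Cfg} (hc : M.step c = some c')
    (h : lo ≤ c.head ∧ c.head ≤ hi) (z : ℤ) :
    next (windowAt lo hi c z) = some (cellAt lo hi c' z) := by
  obtain ⟨⟨q', s', mv⟩, hr, rfl⟩ : ∃ r, M.δ c.state (c.tape c.head) = some r ∧
      { state := r.1, head := c.head + r.2.2.shift,
        tape := Function.update c.tape c.head r.2.1 } = c' := by
    simpa [Machine.step] using hc
  by_cases hz : lo ≤ z ∧ z ≤ hi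
  · by_cases hh : z = c.head
    · subst hh
      rw [windowAt, cellAt_head h, next, hr]
      simp only [cellAt, hz, and_self, if_true, Option.map_some, Function.update_self]
      cases mv <;> simp [isStay, Move.shift]
    · have hcz : cellAt lo hi c z = some (c.tape z, none) := by simp [cellAt, hz, hh]
      rw [windowAt, hcz, next, leaving_cellAt h, leaving_cellAt h, hr]
      simp only [cellAt, hz, and_self, if_true, Function.update_of_ne hh, Option.bind_some]
      congr 3
      cases mv <;> simp [isLeft, isRight, Move.shift]
      · by_cases h1 : z + 1 = c.head
        · simp [show z = c.head + -1 by omega]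
        · simp [h1, show z ≠ c.head + -1 by omega]
      · simp [hh]
      · by_cases h1 : z - 1 = c.head
        · simp [show z = c.head + 1 by omega]
        · simp [h1, show z ≠ c.head + 1 by omega]
  · simp [windowAt, cellAt, hz, next]

theorem next_windowAt_head {lo hi : ℤ} {c : M.Cfg} (hc : M.step c = none)
    (h : lo ≤ c.head ∧ c.head ≤ hi) : next (windowAt lo hi c c.head) = none := by
  have hr : M.δ c.state (c.tape c.head) = none := by simpa [Machine.step] using hc
  rw [windowAt, cellAt_head h, next, hr, Option.map_none]

theorem accepting_cellAt_head {lo hi : ℤ} {c : M.Cfg} (h : lo ≤ c.head ∧ c.head ≤ hi) :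
    Accepting (cellAt lo hi c c.head) ↔ M.step c = none ∧ c.state ∈ M.accept := by
  rw [cellAt_head h]
  simp [Accepting, Machine.step]

theorem accepting_cellAt {lo hi : ℤ} {c : M.Cfg} (hc : M.step c = none) (ha : c.state ∈ M.accept)
    (z : ℤ) : Accepting (cellAt lo hi c z) := by
  unfold cellAt
  by_cases hz : z = c.head
  · subst hz
    split_ifs
    all_goals first | exact ⟨by simpa [Machine.step] using hc, ha⟩ | exact trivial
  · simp only [hz, if_false]
    split_ifs <;> exact trivial

end Windows

/-! ### The clauses -/

/-- Variables that do not depend on a cell. -/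
inductive GVar
  | start | unit | pre | mark | low | cov | far

/-- Variables that depend on a cell and a window. -/
inductive LVar
  | mark | low | cov | seen

instance : Finite GVar :=
  Finite.of_surjective (fun i : Fin 7 => match i with
    | 0 => GVar.start | 1 => .unit | 2 => .pre | 3 => .mark | 4 => .low | 5 => .cov | 6 => .far)
    fun g => by cases g <;> simp [Fin.exists_fin_succ]

instance : Finite LVar :=
  Finite.of_surjective (fun i : Fin 4 => match i with
    | 0 => LVar.mark | 1 => .low | 2 => .cov | 3 => .seen)
    fun g => by cases g <;> simp [Fin.exists_fin_succ]

/-- The number of global variables. -/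
noncomputable def numG : ℕ := Nat.card (GVar × Bool)

/-- The number of local variables per cell. -/
noncomputable def numL (K : ℕ) : ℕ := Nat.card (LVar × Bool × Fin K)

/-- The index of a global variable. -/
noncomputable def gIdx (g : GVar) (e : Bool) : ℕ := Finite.equivFin (GVar × Bool) (g, e)

/-- The index of a local variable. -/
noncomputable def lIdx {K : ℕ} (x : LVar) (e : Bool) (a : Fin K) (k : ℕ) : ℕ :=
  numG + (numL K * k + Finite.equivFin (LVar × Bool × Fin K) (x, e, a))

theorem gIdx_lt (g : GVar) (e : Bool) : gIdx g e < numG := Fin.is_lt _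

theorem gIdx_injective {g g' : GVar} {e e' : Bool} (h : gIdx g e = gIdx g' e') :
    g = g' ∧ e = e' := by
  simpa using (Finite.equivFin (GVar × Bool)).injective (Fin.ext h)

/-- Division with remainder by `numL K`: the quotient is `k`, the remainder is the code of the
triple. -/
theorem lIdx_injective {K : ℕ} {x x' : LVar} {e e' : Bool} {a a' : Fin K} {k k' : ℕ}
    (h : lIdx x e a k = lIdx x' e' a' k') : x = x' ∧ e = e' ∧ a = a' ∧ k = k' := by
  unfold lIdx at h
  set i := Finite.equivFin (LVar × Bool × Fin K) (x, e, a) with hi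
  set i' := Finite.equivFin (LVar × Bool × Fin K) (x', e', a') with hi'
  have hpos : 0 < numL K := i.pos
  have h' : numL K * k + i = numL K * k' + i' := by omega
  have hk : k = k' := by
    have h₁ := congrArg (· / numL K) h'
    have e₁ : (i : ℕ) / numL K = 0 := Nat.div_eq_of_lt i.2
    have e₂ : (i' : ℕ) / numL K = 0 := Nat.div_eq_of_lt i'.2
    simpa [Nat.mul_add_div hpos, e₁, e₂] using h₁
  subst hk
  have : i = i' := Fin.ext (by omega)
  have := (Finite.equivFin (LVar × Bool × Fin K)).injective this
  simp only [Prod.mk.injEq] at this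
  exact ⟨this.1, this.2.1, this.2.2, rfl⟩

theorem shift_gIdx (C k : ℕ) (g : GVar) (e : Bool) : shift numG C k (gIdx g e) = gIdx g e :=
  if_neg (not_le.2 (gIdx_lt g e))

theorem shift_lIdx {K : ℕ} (k : ℕ) (x : LVar) (e : Bool) (a : Fin K) (j : ℕ) :
    shift numG (numL K) k (lIdx x e a j) = lIdx x e a (k + j) := by
  rw [shift, if_pos (by unfold lIdx; omega), lIdx, lIdx]
  ring

/-- Global variables as literals. -/
noncomputable def G (g : GVar) (e : Bool) : Literal := .var (gIdx g e)

/-- Local variables as literals. -/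
noncomputable def V {K : ℕ} (x : LVar) (e : Bool) (a : Fin K) (k : ℕ) : Literal :=
  .var (lIdx x e a k)

/-- `l` holds at some interval with the same left end. -/
def col (l : Literal) : Literal := .dia .afterInv (.dia .after l)

/-- The clauses that do not depend on a cell, for the parity `e`. -/
noncomputable def globalBlock (e : Bool) : List CoreFormula :=
    [.imp (G .start false) (G .unit false),
     -- A candidate of the other parity starts at the end of each unit.
     .imp (G .unit e) (.dia .after (G .pre !e)),
     .imp (G .pre e) (col (G .mark e)),
     .imp (G .mark e) (G .low e),
     .imp (G .mark e) (.box .begins (G .low e)),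
     .imp (G .mark e) (G .cov e),
     .imp (G .mark e) (.box .beginsInv (G .cov e)),
     .imp (G .pre e) (G .cov e),
     .imp (G .pre e) (.box .begins (G .cov e)),
     -- Fires if the marker is shorter than the candidate. The conclusion is boxed because the
     -- premise is vacuously true at intervals without successors under `after`.
     .imp (.box .after (G .cov e)) (.box .after (col (G .unit e))),
     -- `far` is forced at the intervals that start no later and end later than a candidate or unit;
     -- it limits the markers of the other parity.
     .imp (G .pre e) (.box .beginsInv (G .far e)),
     .imp (G .pre e) (.box .endsInv (.box .beginsInv (G .far e))),
     .imp (G .unit e) (.box .beginsInv (G .far e)),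
     .imp (G .unit e) (.box .endsInv (.box .beginsInv (G .far e)))]

/-- The clauses that do not depend on a cell. -/
noncomputable def globalClauses : List CoreFormula := globalBlock false ++ globalBlock true

section Cells

variable {A : Type} {M : Machine A}

open Classical in
/-- The clauses for a cell with initial content `γ`, the parity `e` and the windows `a` and `b`;
the variables of the cell have index `1`, those of its neighbours `0` and `2`. -/
noncomputable def cellBlock (γ : Cel M) (e : Bool) (a b : Fin (numWin M)) : List CoreFormula :=
    -- The first window is tried at every unit. Clauses that do not apply to the given `a` and `b`
    -- are made trivial by a literal `⊥` or `⊤`, so that all blocks have the same shape.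
    [.imp (if (a : ℕ) = 0 then G .unit e else .bot) (col (V .mark e a 1)),
     .imp (V .mark e a 1) (V .low e a 1),
     .imp (V .mark e a 1) (.box .begins (V .low e a 1)),
     .imp (V .mark e a 1) (V .cov e a 1),
     .imp (V .mark e a 1) (.box .beginsInv (V .cov e a 1)),
     .imp (G .unit e) (V .cov e a 1),
     .imp (G .unit e) (.box .begins (V .cov e a 1)),
     -- If the marker of a window is too short, the next window is tried; the clause after this one
     -- forbids it for the last window.
     .imp (.box .after (V .cov e a 1))
       (.box .after (if (b : ℕ) = a + 1 then col (V .mark e b 1) else .top)),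
     .imp (.box .after (V .cov e a 1))
       (.box .after (if (a : ℕ) + 1 = numWin M then .bot else .top)),
     -- `seen` is forced at the intervals that start within the marker and end no earlier than it.
     .imp (V .mark e a 1) (V .seen e a 1),
     .imp (V .mark e a 1) (.box .beginsInv (V .seen e a 1)),
     .imp (V .mark e a 1) (.box .ends (V .seen e a 1)),
     .imp (V .mark e a 1) (.box .ends (.box .beginsInv (V .seen e a 1))),
     .disj (G .far e) (V .mark (!e) a 1),
     -- A long marker of the candidate puts `low` on it; the windows seen there must then be
     -- accepting.
     .disj (G .low e) (if Accepting (win M a).2.1 then .bot else V .seen (!e) a 1),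
     -- The new content of the cell is compared with the three windows that contain it: its own, and
     -- those of its right and left neighbours.
     .disj (if next (win M a) = some (win M b).2.1 then .bot else V .low e b 1) (V .seen (!e) a 1),
     .disj (if next (win M a) = some (win M b).1 then .bot else V .low e b 2) (V .seen (!e) a 1),
     .disj (if next (win M a) = some (win M b).2.2 then .bot else V .low e b 0) (V .seen (!e) a 1),
     .disj (G .start false) (if γ = (win M b).2.1 then .bot else V .low false b 1),
     .disj (G .start false) (if γ = (win M b).1 then .bot else V .low false b 2),
     .disj (G .start false) (if γ = (win M b).2.2 then .bot else V .low false b 0)]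

/-- The clauses for a cell with initial content `γ`. -/
noncomputable def cellClauses (γ : Cel M) : List CoreFormula :=
  (Finset.univ : Finset (Bool × Fin (numWin M) × Fin (numWin M))).toList.flatMap fun i =>
    cellBlock γ i.1 i.2.1 i.2.2

end Cells

/-! ### The clauses as conditions on a valuation -/

section Conditions

variable {T : Type*} [LinearOrder T] (sem : IntervalRel → Semantics)
  (ν : ℕ → Set (NonemptyInterval T))

/-- Membership in the value of a global variable. -/
def GH (g : GVar) (e : Bool) (I : NonemptyInterval T) : Prop := I ∈ ν (gIdx g e)

/-- Membership in the value of a local variable. -/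
def LH {K : ℕ} (x : LVar) (e : Bool) (a : Fin K) (k : ℕ) (I : NonemptyInterval T) : Prop :=
  I ∈ ν (lIdx x e a k)

/-- Some interval with the same left end has the property `P`. -/
def Col (P : NonemptyInterval T → Prop) (I : NonemptyInterval T) : Prop :=
  ∃ J, IntervalRel.afterInv.holds (sem .afterInv) I J ∧
    ∃ J', IntervalRel.after.holds (sem .after) J J' ∧ P J'

variable {A : Type} {M : Machine A}

/-- The conditions on a valuation that the clauses of the cell with index `k` express. -/
structure CellConditions (γ : Cel M) (k : ℕ) (e : Bool) (a b : Fin (numWin M)) : Prop where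
  unit_mark : (a : ℕ) = 0 → ∀ I, GH ν .unit e I → Col sem (LH ν .mark e a (k + 1)) I
  mark_low : ∀ I, LH ν .mark e a (k + 1) I → LH ν .low e a (k + 1) I
  mark_begins : ∀ I, LH ν .mark e a (k + 1) I →
    ∀ J, IntervalRel.begins.holds (sem .begins) I J → LH ν .low e a (k + 1) J
  mark_cov : ∀ I, LH ν .mark e a (k + 1) I → LH ν .cov e a (k + 1) I
  mark_beginsInv : ∀ I, LH ν .mark e a (k + 1) I →
    ∀ J, IntervalRel.beginsInv.holds (sem .beginsInv) I J → LH ν .cov e a (k + 1) J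
  unit_cov : ∀ I, GH ν .unit e I → LH ν .cov e a (k + 1) I
  unit_begins : ∀ I, GH ν .unit e I →
    ∀ J, IntervalRel.begins.holds (sem .begins) I J → LH ν .cov e a (k + 1) J
  cov_mark : (b : ℕ) = a + 1 → ∀ I,
    (∀ J, IntervalRel.after.holds (sem .after) I J → LH ν .cov e a (k + 1) J) →
      ∀ J, IntervalRel.after.holds (sem .after) I J → Col sem (LH ν .mark e b (k + 1)) J
  cov_last : (a : ℕ) + 1 = numWin M → ∀ I,
    (∀ J, IntervalRel.after.holds (sem .after) I J → LH ν .cov e a (k + 1) J) →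
      ∀ J, ¬ IntervalRel.after.holds (sem .after) I J
  mark_seen : ∀ I, LH ν .mark e a (k + 1) I → LH ν .seen e a (k + 1) I
  mark_seen₁ : ∀ I, LH ν .mark e a (k + 1) I →
    ∀ J, IntervalRel.beginsInv.holds (sem .beginsInv) I J → LH ν .seen e a (k + 1) J
  mark_seen₂ : ∀ I, LH ν .mark e a (k + 1) I →
    ∀ J, IntervalRel.ends.holds (sem .ends) I J → LH ν .seen e a (k + 1) J
  mark_seen₃ : ∀ I, LH ν .mark e a (k + 1) I →
    ∀ J, IntervalRel.ends.holds (sem .ends) I J →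
      ∀ J', IntervalRel.beginsInv.holds (sem .beginsInv) J J' → LH ν .seen e a (k + 1) J'
  far_mark : ∀ I, GH ν .far e I → ¬ LH ν .mark (!e) a (k + 1) I
  low_seen : ¬ Accepting (win M a).2.1 → ∀ I, GH ν .low e I → ¬ LH ν .seen (!e) a (k + 1) I
  next_mid : next (win M a) ≠ some (win M b).2.1 →
    ∀ I, LH ν .low e b (k + 1) I → ¬ LH ν .seen (!e) a (k + 1) I
  next_left : next (win M a) ≠ some (win M b).1 →
    ∀ I, LH ν .low e b (k + 2) I → ¬ LH ν .seen (!e) a (k + 1) I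
  next_right : next (win M a) ≠ some (win M b).2.2 →
    ∀ I, LH ν .low e b k I → ¬ LH ν .seen (!e) a (k + 1) I
  start_mid : γ ≠ (win M b).2.1 →
    ∀ I, GH ν .start false I → ¬ LH ν .low false b (k + 1) I
  start_left : γ ≠ (win M b).1 →
    ∀ I, GH ν .start false I → ¬ LH ν .low false b (k + 2) I
  start_right : γ ≠ (win M b).2.2 →
    ∀ I, GH ν .start false I → ¬ LH ν .low false b k I

/-- The conditions on a valuation that the global clauses express. -/
structure GlobalConditions (e : Bool) : Prop where
  start_unit : ∀ I, GH ν .start false I → GH ν .unit false I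
  unit_pre : ∀ I, GH ν .unit e I →
    ∃ J, IntervalRel.after.holds (sem .after) I J ∧ GH ν .pre (!e) J
  pre_mark : ∀ I, GH ν .pre e I → Col sem (GH ν .mark e) I
  mark_low : ∀ I, GH ν .mark e I → GH ν .low e I
  mark_begins : ∀ I, GH ν .mark e I →
    ∀ J, IntervalRel.begins.holds (sem .begins) I J → GH ν .low e J
  mark_cov : ∀ I, GH ν .mark e I → GH ν .cov e I
  mark_beginsInv : ∀ I, GH ν .mark e I →
    ∀ J, IntervalRel.beginsInv.holds (sem .beginsInv) I J → GH ν .cov e J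
  pre_cov : ∀ I, GH ν .pre e I → GH ν .cov e I
  pre_begins : ∀ I, GH ν .pre e I →
    ∀ J, IntervalRel.begins.holds (sem .begins) I J → GH ν .cov e J
  cov_unit : ∀ I, (∀ J, IntervalRel.after.holds (sem .after) I J → GH ν .cov e J) →
      ∀ J, IntervalRel.after.holds (sem .after) I J → Col sem (GH ν .unit e) J
  pre_far : ∀ I, GH ν .pre e I →
    ∀ J, IntervalRel.beginsInv.holds (sem .beginsInv) I J → GH ν .far e J
  pre_far₁ : ∀ I, GH ν .pre e I → ∀ J, IntervalRel.endsInv.holds (sem .endsInv) I J →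
    ∀ J', IntervalRel.beginsInv.holds (sem .beginsInv) J J' → GH ν .far e J'
  unit_far : ∀ I, GH ν .unit e I →
    ∀ J, IntervalRel.beginsInv.holds (sem .beginsInv) I J → GH ν .far e J
  unit_far₁ : ∀ I, GH ν .unit e I → ∀ J, IntervalRel.endsInv.holds (sem .endsInv) I J →
    ∀ J', IntervalRel.beginsInv.holds (sem .beginsInv) J J' → GH ν .far e J'

theorem holds_globalBlock (e : Bool) (I : NonemptyInterval T) :
    (∀ φ ∈ globalBlock e, φ.Holds sem ν I) ↔ GlobalConditions sem ν e := by
  simp only [globalBlock, List.mem_cons, List.not_mem_nil, or_false, forall_eq_or_imp, forall_eq]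
  constructor
  · rintro ⟨h1, h2, h3, h4, h5, h6, h7, h8, h9, h10, h11, h12, h13, h14⟩
    exact ⟨h1, h2, h3, h4, h5, h6, h7, h8, h9, h10, h11, h12, h13, h14⟩
  · intro h
    exact ⟨h.1, h.2, h.3, h.4, h.5, h.6, h.7, h.8, h.9, h.10, h.11, h.12, h.13, h.14⟩

theorem holds_globalClauses (I : NonemptyInterval T) :
    (∀ φ ∈ globalClauses, φ.Holds sem ν I) ↔ ∀ e, GlobalConditions sem ν e := by
  simp only [globalClauses, List.mem_append, or_imp, forall_and, holds_globalBlock,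
    Bool.forall_bool]

theorem Literal.holds_ite {P : Prop} [Decidable P] (l l' : Literal) (I : NonemptyInterval T) :
    (if P then l else l').Holds sem ν I ↔ (P → l.Holds sem ν I) ∧ (¬ P → l'.Holds sem ν I) := by
  split_ifs with h <;> simp [h]

theorem holds_cellBlock (γ : Cel M) (k : ℕ) (e : Bool) (a b : Fin (numWin M))
    (I : NonemptyInterval T) :
    (∀ φ ∈ cellBlock γ e a b, (φ.rename (shift numG (numL (numWin M)) k)).Holds sem ν I) ↔
      CellConditions sem ν γ k e a b := by
  unfold cellBlock
  simp only [CoreFormula.holds_rename, List.mem_cons, List.not_mem_nil, or_false,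
    forall_eq_or_imp, forall_eq]
  simp only [CoreFormula.Holds, Literal.holds_ite, G, V, col, Literal.Holds, shift_gIdx,
    shift_lIdx]
  constructor
  · rintro ⟨h1, h2, h3, h4, h5, h6, h7, h8, h9, h10, h11, h12, h13, h14, h15, h16, h17, h18, h19,
      h20, h21⟩
    exact ⟨fun h I hI => h1 I ⟨fun _ => hI, fun h' => h' h⟩, h2, h3, h4, h5, h6, h7,
      fun h I hI J hJ => (h8 I hI J hJ).1 h, fun h I hI J hJ => (h9 I hI J hJ).1 h,
      h10, h11, h12, h13, fun I h h' => h14 I ⟨h, h'⟩,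
      fun hn I h h' => h15 I ⟨h, fun h => hn h, fun _ => h'⟩,
      fun hn I h h' => h16 I ⟨⟨fun h => hn h, fun _ => h⟩, h'⟩,
      fun hn I h h' => h17 I ⟨⟨fun h => hn h, fun _ => h⟩, h'⟩,
      fun hn I h h' => h18 I ⟨⟨fun h => hn h, fun _ => h⟩, h'⟩,
      fun hn I h h' => h19 I ⟨h, fun h => hn h, fun _ => h'⟩,
      fun hn I h h' => h20 I ⟨h, fun h => hn h, fun _ => h'⟩,
      fun hn I h h' => h21 I ⟨h, fun h => hn h, fun _ => h'⟩⟩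
  · intro h
    exact ⟨fun I hI => by
        by_cases h0 : (a : ℕ) = 0
        · exact h.unit_mark h0 I (hI.1 h0)
        · exact (hI.2 h0).elim,
      h.2, h.3, h.4, h.5, h.6, h.7,
      fun I hI J hJ => ⟨fun hb => h.cov_mark hb I hI J hJ, fun _ => trivial⟩,
      fun I hI J hJ => ⟨fun hb => h.cov_last hb I hI J hJ, fun _ => trivial⟩,
      h.10, h.11, h.12, h.13, fun I hI => h.far_mark I hI.1 hI.2,
      fun I hI => h.low_seen (fun hn => hI.2.1 hn) I hI.1 (hI.2.2 fun hn => hI.2.1 hn),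
      fun I hI => h.next_mid (fun hn => hI.1.1 hn) I (hI.1.2 fun hn => hI.1.1 hn) hI.2,
      fun I hI => h.next_left (fun hn => hI.1.1 hn) I (hI.1.2 fun hn => hI.1.1 hn) hI.2,
      fun I hI => h.next_right (fun hn => hI.1.1 hn) I (hI.1.2 fun hn => hI.1.1 hn) hI.2,
      fun I hI => h.start_mid (fun hn => hI.2.1 hn) I hI.1 (hI.2.2 fun hn => hI.2.1 hn),
      fun I hI => h.start_left (fun hn => hI.2.1 hn) I hI.1 (hI.2.2 fun hn => hI.2.1 hn),
      fun I hI => h.start_right (fun hn => hI.2.1 hn) I hI.1 (hI.2.2 fun hn => hI.2.1 hn)⟩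

theorem holds_cellClauses (γ : Cel M) (k : ℕ) (I : NonemptyInterval T) :
    (∀ φ ∈ cellClauses γ, (φ.rename (shift numG (numL (numWin M)) k)).Holds sem ν I) ↔
      ∀ e a b, CellConditions sem ν γ k e a b := by
  simp only [cellClauses, List.mem_flatMap, Finset.mem_toList, Finset.mem_univ, true_and,
    ← holds_cellBlock sem ν γ k _ _ _ I]
  exact ⟨fun h e a b φ hφ => h φ ⟨(e, a, b), hφ⟩, fun h φ ⟨i, hφ⟩ => h i.1 i.2.1 i.2.2 φ hφ⟩

end Conditions

end HS

namespace HS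

open PolySpace StateTransition

/-! ### Models of the clauses yield accepting computations -/

section Intervals

variable {T : Type*} [LinearOrder T]

/-- This and `Semantics.le_of_lt` are all that the proof uses about the two readings. -/
theorem Semantics.lt_of_lt {x y : T} (s : Semantics) (h : x < y) : s.lt x y := by
  cases s
  · exact h
  · exact h.le

theorem Semantics.le_of_lt {x y : T} {s : Semantics} (h : s.lt x y) : x ≤ y := by
  cases s
  · exact LT.lt.le h
  · exact h

variable {sem : IntervalRel → Semantics}

theorem Col.exists {P : NonemptyInterval T → Prop} {I : NonemptyInterval T} (h : Col sem P I) :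
    ∃ J, J.fst = I.fst ∧ P J :=
  let ⟨_, h₁, J, h₂, hP⟩ := h
  ⟨J, h₂.1.symm.trans h₁.1, hP⟩

/-- If a property holds at `R` and above it, and at `J` and below it, where `R` and `J` have the
same left end and `R` is shorter than `J`, then it holds at all intervals with this left end. -/
theorem covers {P : NonemptyInterval T → Prop} {R J : NonemptyInterval T} (hRJ : R.fst = J.fst)
    (hlt : R.snd < J.snd)
    (hR : ∀ I, IntervalRel.beginsInv.holds (sem .beginsInv) R I → P I) (hJ : P J)
    (hJ' : ∀ I, IntervalRel.begins.holds (sem .begins) J I → P I) (I : NonemptyInterval T)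
    (hI : I.fst = J.fst) : P I := by
  rcases lt_trichotomy I.snd J.snd with h | h | h
  · exact hJ' I ⟨hI.symm, Semantics.lt_of_lt _ h⟩
  · rwa [NonemptyInterval.ext (Prod.ext hI h)]
  · exact hR I ⟨hRJ.trans hI.symm, Semantics.lt_of_lt _ (hlt.trans h)⟩

/-- The interval at which all successors under `after` are the intervals that start with `J`. -/
theorem after_pure {J : NonemptyInterval T} (h : J.fst < J.snd) :
    IntervalRel.after.holds (sem .after) (NonemptyInterval.pure J.fst) J :=
  ⟨rfl, Semantics.lt_of_lt _ h⟩

theorem fst_of_after_pure {x : T} {J : NonemptyInterval T}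
    (h : IntervalRel.after.holds (sem .after) (NonemptyInterval.pure x) J) : J.fst = x :=
  h.1.symm

end Intervals

section Soundness

variable {T : Type*} [LinearOrder T] {sem : IntervalRel → Semantics}
  {ν : ℕ → Set (NonemptyInterval T)} {A : Type} {M : Machine A}

theorem numWin_pos : 0 < numWin M := Nat.card_pos_iff.2 ⟨⟨(none, none, none)⟩, inferInstance⟩

/-- At every unit, one of the windows is chosen for every cell. -/
theorem exists_mark {γ : Cel M} {k : ℕ} {e : Bool} (h : ∀ a b, CellConditions sem ν γ k e a b)
    {J : NonemptyInterval T} (hJ : GH ν .unit e J) :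
    ∃ (a : Fin (numWin M)) (R : NonemptyInterval T),
      LH ν .mark e a (k + 1) R ∧ R.fst = J.fst ∧ J.snd ≤ R.snd := by
  -- If all markers are too short, the windows are tried up to the last one, where `cov_last` gives
  -- a contradiction.
  by_contra! hno
  have hcov : ∀ (a : Fin (numWin M)) (R : NonemptyInterval T), LH ν .mark e a (k + 1) R →
      R.fst = J.fst → J.fst < J.snd ∧ ∀ I, IntervalRel.after.holds (sem .after)
        (NonemptyInterval.pure J.fst) I → LH ν .cov e a (k + 1) I := by
    intro a R hR hRJ
    have hlt := hno a R hR hRJ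
    refine ⟨lt_of_le_of_lt (hRJ ▸ R.fst_le_snd) hlt, fun I hI => ?_⟩
    exact covers hRJ hlt ((h a a).mark_beginsInv R hR) ((h a a).unit_cov J hJ)
      ((h a a).unit_begins J hJ) I (fst_of_after_pure hI)
  have hall : ∀ n (hn : n < numWin M), ∃ R, LH ν .mark e (⟨n, hn⟩ : Fin _) (k + 1) R ∧
      R.fst = J.fst := by
    intro n
    induction n with
    | zero =>
      intro hn
      obtain ⟨R, hR, hR'⟩ := ((h ⟨0, hn⟩ ⟨0, hn⟩).unit_mark rfl J hJ).exists
      exact ⟨R, hR', hR⟩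
    | succ n ih =>
      intro hn
      obtain ⟨R, hR, hRJ⟩ := ih (by omega)
      obtain ⟨hlt, hc⟩ := hcov _ R hR hRJ
      obtain ⟨R', hR', hR''⟩ :=
        ((h _ ⟨n + 1, hn⟩).cov_mark rfl _ hc J (after_pure hlt)).exists
      exact ⟨R', hR'', hR'⟩
  have hK := numWin_pos (M := M)
  obtain ⟨R, hR, hRJ⟩ := hall (numWin M - 1) (by omega)
  obtain ⟨hlt, hc⟩ := hcov _ R hR hRJ
  exact (h _ ⟨0, hK⟩).cov_last (by simp; omega) _ hc J (after_pure hlt)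

theorem low_of_mark {γ : Cel M} {k : ℕ} {e : Bool} {a b : Fin (numWin M)}
    (h : CellConditions sem ν γ k e a b) {R J : NonemptyInterval T}
    (hR : LH ν .mark e a (k + 1) R) (hRJ : R.fst = J.fst) (hle : J.snd ≤ R.snd) :
    LH ν .low e a (k + 1) J := by
  rcases hle.lt_or_eq with hlt | heq
  · exact h.mark_begins R hR J ⟨hRJ, Semantics.lt_of_lt _ hlt⟩
  · rw [← NonemptyInterval.ext (Prod.ext hRJ heq.symm)]
    exact h.mark_low R hR

/-- Each combination of `<` and `=` at the two ends has its own clause, so no reading has to be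
known. If both are strict, the path leads through the interval from `J.fst` to `R.snd`. -/
theorem seen_of_mark {γ : Cel M} {k : ℕ} {e : Bool} {a b : Fin (numWin M)}
    (h : CellConditions sem ν γ k e a b) {R J : NonemptyInterval T}
    (hR : LH ν .mark e a (k + 1) R) (h₁ : R.fst ≤ J.fst) (h₂ : J.fst ≤ R.snd)
    (h₃ : R.snd ≤ J.snd) : LH ν .seen e a (k + 1) J := by
  rcases h₁.lt_or_eq with h₁ | h₁ <;> rcases h₃.lt_or_eq with h₃ | h₃
  · exact h.mark_seen₃ R hR ⟨(J.fst, R.snd), h₂⟩ ⟨Semantics.lt_of_lt _ h₁, rfl⟩ J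
      ⟨rfl, Semantics.lt_of_lt _ h₃⟩
  · exact h.mark_seen₂ R hR J ⟨Semantics.lt_of_lt _ h₁, h₃⟩
  · exact h.mark_seen₁ R hR J ⟨h₁, Semantics.lt_of_lt _ h₃⟩
  · rw [← NonemptyInterval.ext (Prod.ext h₁ h₃)]
    exact h.mark_seen R hR

theorem far_of {e : Bool} {J R : NonemptyInterval T}
    (hJ : ∀ I, IntervalRel.beginsInv.holds (sem .beginsInv) J I → GH ν .far e I)
    (hJ' : ∀ I, IntervalRel.endsInv.holds (sem .endsInv) J I →
      ∀ I', IntervalRel.beginsInv.holds (sem .beginsInv) I I' → GH ν .far e I')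
    (h₁ : R.fst ≤ J.fst) (h₂ : J.snd < R.snd) : GH ν .far e R := by
  rcases h₁.lt_or_eq with h₁ | h₁
  · exact hJ' ⟨(R.fst, J.snd), h₁.le.trans J.fst_le_snd⟩ ⟨Semantics.lt_of_lt _ h₁, rfl⟩ R
      ⟨rfl, Semantics.lt_of_lt _ h₂⟩
  · exact hJ R ⟨h₁.symm, Semantics.lt_of_lt _ h₂⟩

variable (sem ν) in
/-- The conditions expressed by all clauses, for the list `cel` of the initial contents of the
cells. -/
structure Conditions (cel : List (Cel M)) : Prop where
  global : ∀ e, GlobalConditions sem ν e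
  cell : ∀ k γ, cel[k]? = some γ → ∀ e a b, CellConditions sem ν γ k e a b

variable (ν) in
/-- Some unit with parity `e` encodes the configuration `c`, in the cells with indices below
`N`. -/
def UnitFor (lo hi : ℤ) (N : ℕ) (e : Bool) (c : M.Cfg) : Prop :=
  ∃ J, GH ν .unit e J ∧ ∀ k < N, ∃ (a : Fin (numWin M)) (R : NonemptyInterval T),
    LH ν .mark e a (k + 1) R ∧ R.fst = J.fst ∧ J.snd ≤ R.snd ∧
    (win M a).2.1 = cellAt lo hi c (lo - 1 + k) ∧
    (0 < k → (win M a).1 = cellAt lo hi c (lo - 1 + k - 1)) ∧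
    (k + 1 < N → (win M a).2.2 = cellAt lo hi c (lo - 1 + k + 1))

variable {lo hi : ℤ} {N : ℕ} {cel : List (Cel M)}

/-- The windows of the first and the last cell are known only in part. These cells are borders, for
which `next` ignores the neighbours. -/
theorem next_eq_next_windowAt (hN : (N : ℤ) = hi - lo + 3) {c : M.Cfg} {k : ℕ} (_ : k < N)
    {a : Fin (numWin M)} (h₁ : (win M a).2.1 = cellAt lo hi c (lo - 1 + k))
    (h₂ : 0 < k → (win M a).1 = cellAt lo hi c (lo - 1 + k - 1))
    (h₃ : k + 1 < N → (win M a).2.2 = cellAt lo hi c (lo - 1 + k + 1)) :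
    next (win M a) = next (windowAt lo hi c (lo - 1 + k)) := by
  by_cases hb : 0 < k ∧ k + 1 < N
  · congr 1
    exact Prod.ext (h₂ hb.1) (Prod.ext h₁ (h₃ hb.2))
  · have hnone : cellAt lo hi c (lo - 1 + k) = none := by
      rw [cellAt, if_neg]
      rintro ⟨h, h'⟩
      omega
    rw [hnone] at h₁
    rw [windowAt, hnone, next]
    generalize win M a = w at h₁
    obtain ⟨l, m, r⟩ := w
    obtain rfl : m = none := h₁
    rfl

/-- The components of a selected window are checked by different cells: the middle by the cell
itself, the outer ones by its neighbours. -/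
theorem unitFor_init (hN : (N : ℤ) = hi - lo + 3) {c : M.Cfg}
    (hcel : ∀ k < N, cel[k]? = some (cellAt lo hi c (lo - 1 + k)))
    (h : Conditions sem ν cel) {I : NonemptyInterval T} (hI : GH ν .start false I) :
    UnitFor ν lo hi N false c := by
  refine ⟨I, (h.global false).start_unit I hI, fun k hk => ?_⟩
  have hc := fun k (hk : k < N) => h.cell k _ (hcel k hk)
  obtain ⟨a, R, hR, hRI, hle⟩ := exists_mark (hc k hk false) ((h.global false).start_unit I hI)
  have hlow := low_of_mark (hc k hk false a a) hR hRI hle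
  refine ⟨a, R, hR, hRI, hle, ?_, fun hk0 => ?_, fun hkN => ?_⟩
  · by_contra hne
    exact (hc k hk false a a).start_mid (Ne.symm hne) I hI hlow
  · by_contra hne
    obtain ⟨k, rfl⟩ := Nat.exists_eq_succ_of_ne_zero hk0.ne'
    refine (hc k (by omega) false a a).start_left (fun h => hne ?_) I hI hlow
    rw [← h]; congr 1; push_cast; ring
  · by_contra hne
    refine (hc (k + 1) (by omega) false a a).start_right (fun h => hne ?_) I hI hlow
    rw [← h]; congr 1; push_cast; ring

/-- The dichotomy on the marker of the candidate: if long, all cells accept; if short, there is a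
next unit. In both cases the selected windows are seen, because their markers reach the end of the
present unit and `far` stops them from passing the end of what follows. -/
theorem UnitFor.next_unit (hN : (N : ℤ) = hi - lo + 3)
    (hcel : ∀ k < N, ∃ γ, cel[k]? = some γ)
    (h : Conditions sem ν cel) {e : Bool} {c : M.Cfg} (hc : UnitFor ν lo hi N e c) :
    (∀ k < N, Accepting (cellAt lo hi c (lo - 1 + k))) ∨ ∃ J, GH ν .unit (!e) J ∧
      ∀ k < N, ∃ a : Fin (numWin M),
        next (win M a) = next (windowAt lo hi c (lo - 1 + k)) ∧ LH ν .seen e a (k + 1) J := by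
  have hcc : ∀ k < N, ∃ γ, ∀ e a b, CellConditions sem ν γ k e a b := fun k hk =>
    let ⟨γ, hγ⟩ := hcel k hk
    ⟨γ, h.cell k γ hγ⟩
  obtain ⟨J, hJ, hJc⟩ := hc
  obtain ⟨j, hJj, hj⟩ := (h.global e).unit_pre J hJ
  have hJj : J.snd = j.fst := hJj.1
  have hg := h.global (!e)
  -- Applied to the candidate in the first case and to the next unit in the second. They share the
  -- left end but may differ in length.
  have key : ∀ j', j'.fst = J.snd →
      (∀ I, IntervalRel.beginsInv.holds (sem .beginsInv) j' I → GH ν .far (!e) I) →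
      (∀ I, IntervalRel.endsInv.holds (sem .endsInv) j' I →
        ∀ I', IntervalRel.beginsInv.holds (sem .beginsInv) I I' → GH ν .far (!e) I') →
      ∀ k < N, ∃ a : Fin (numWin M), (win M a).2.1 = cellAt lo hi c (lo - 1 + k) ∧
        next (win M a) = next (windowAt lo hi c (lo - 1 + k)) ∧ LH ν .seen e a (k + 1) j' := by
    intro j' hj' hf₁ hf₂ k hk
    obtain ⟨a, R, hR, hRJ, hle, hw₁, hw₂, hw₃⟩ := hJc k hk
    obtain ⟨γ, hγ⟩ := hcc k hk
    have hfst : R.fst ≤ j'.fst := by rw [hRJ, hj']; exact J.fst_le_snd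
    refine ⟨a, hw₁, next_eq_next_windowAt hN hk hw₁ hw₂ hw₃,
      seen_of_mark (hγ e a a) hR hfst (hj' ▸ hle) ?_⟩
    by_contra! hlt
    exact (hγ (!e) a a).far_mark R (far_of hf₁ hf₂ hfst hlt) (by rwa [Bool.not_not])
  obtain ⟨r, hrj, hr⟩ := (hg.pre_mark j hj).exists
  rcases le_or_gt j.snd r.snd with hle | hlt
  · left
    intro k hk
    obtain ⟨a, hw, -, hs⟩ := key j hJj.symm (hg.pre_far j hj) (hg.pre_far₁ j hj) k hk
    obtain ⟨γ, hγ⟩ := hcc k hk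
    rw [← hw]
    by_contra hna
    refine (hγ (!e) a a).low_seen hna j ?_ (by rwa [Bool.not_not])
    rcases hle.lt_or_eq with hlt | heq
    · exact hg.mark_begins r hr j ⟨hrj, Semantics.lt_of_lt _ hlt⟩
    · rw [← NonemptyInterval.ext (Prod.ext hrj heq.symm)]
      exact hg.mark_low r hr
  · right
    have hlt' : j.fst < j.snd := lt_of_le_of_lt (hrj ▸ r.fst_le_snd) hlt
    obtain ⟨J', hJ', hu⟩ := (hg.cov_unit (NonemptyInterval.pure j.fst) (fun I hI =>
      covers hrj hlt (hg.mark_beginsInv r hr) (hg.pre_cov j hj) (hg.pre_begins j hj) I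
        (fst_of_after_pure hI)) j (after_pure hlt')).exists
    refine ⟨J', hu, fun k hk => ?_⟩
    obtain ⟨a, -, hn, hs⟩ := key J' (hJ'.trans hJj.symm) (hg.unit_far J' hu)
      (hg.unit_far₁ J' hu) k hk
    exact ⟨a, hn, hs⟩

/-- A halted machine has no next unit: at the head `next` is `none`, which agrees with no window.
Otherwise the old windows are seen at the new unit and the new ones are `low` there, so the
comparison clauses fix the new contents. -/
theorem UnitFor.step (hN : (N : ℤ) = hi - lo + 3)
    (hcel : ∀ k < N, ∃ γ, cel[k]? = some γ)
    (h : Conditions sem ν cel) {e : Bool} {c : M.Cfg} (hb : lo ≤ c.head ∧ c.head ≤ hi)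
    (hc : UnitFor ν lo hi N e c) :
    (M.step c = none ∧ c.state ∈ M.accept) ∨
      ∃ c', M.step c = some c' ∧ UnitFor ν lo hi N (!e) c' := by
  have hcc : ∀ k < N, ∃ γ, ∀ e a b, CellConditions sem ν γ k e a b := fun k hk =>
    let ⟨γ, hγ⟩ := hcel k hk
    ⟨γ, h.cell k γ hγ⟩
  -- The index of the scanned cell; index `0` is the left border `lo - 1`.
  obtain ⟨m, hm⟩ : ∃ m : ℕ, lo - 1 + m = c.head := ⟨(c.head - lo + 1).toNat, by omega⟩
  have hmN : m < N := by omega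
  rcases hc.next_unit hN hcel h with hacc | ⟨J, hJ, hJs⟩
  · left
    have := hacc m hmN
    rwa [hm, accepting_cellAt_head hb] at this
  · right
    cases hs : M.step c with
    | none =>
      exfalso
      obtain ⟨a, ha, hsa⟩ := hJs m hmN
      rw [hm, next_windowAt_head hs hb] at ha
      obtain ⟨γ, hγ⟩ := hcc m hmN
      obtain ⟨b, R, hR, hRJ, hle⟩ := exists_mark (hγ (!e)) hJ
      exact (hγ (!e) a b).next_mid (by simp [ha]) J (low_of_mark (hγ (!e) b b) hR hRJ hle)
        (by rwa [Bool.not_not])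
    | some c' =>
      refine ⟨c', rfl, J, hJ, fun k hk => ?_⟩
      obtain ⟨γ, hγ⟩ := hcc k hk
      obtain ⟨b, R, hR, hRJ, hle⟩ := exists_mark (hγ (!e)) hJ
      have hlow := low_of_mark (hγ (!e) b b) hR hRJ hle
      refine ⟨b, R, hR, hRJ, hle, ?_, fun hk0 => ?_, fun hkN => ?_⟩
      · obtain ⟨a, ha, hsa⟩ := hJs k hk
        rw [next_windowAt hs hb] at ha
        by_contra hne
        exact (hγ (!e) a b).next_mid (by rw [ha]; simpa using Ne.symm hne) J hlow
          (by rwa [Bool.not_not])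
      · obtain ⟨k, rfl⟩ := Nat.exists_eq_succ_of_ne_zero hk0.ne'
        obtain ⟨a, ha, hsa⟩ := hJs k (by omega)
        obtain ⟨γ', hγ'⟩ := hcc k (by omega)
        rw [next_windowAt hs hb] at ha
        by_contra hne
        refine (hγ' (!e) a b).next_left (fun hh => hne ?_) J hlow (by rwa [Bool.not_not])
        rw [ha, Option.some_inj] at hh
        rw [← hh]; congr 1; push_cast; ring
      · obtain ⟨a, ha, hsa⟩ := hJs (k + 1) hkN
        obtain ⟨γ', hγ'⟩ := hcc (k + 1) hkN
        rw [next_windowAt hs hb] at ha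
        by_contra hne
        refine (hγ' (!e) a b).next_right (fun hh => hne ?_) J hlow (by rwa [Bool.not_not])
        rw [ha, Option.some_inj] at hh
        rw [← hh]; congr 1; push_cast; ring

/-- If the clauses are satisfied, the computation from the configuration `c` accepts. -/
theorem accepts_of_conditions (hN : (N : ℤ) = hi - lo + 3) {c : M.Cfg}
    (hcel : ∀ k < N, cel[k]? = some (cellAt lo hi c (lo - 1 + k)))
    (hb : ∀ c', Reaches M.step c c' → lo ≤ c'.head ∧ c'.head ≤ hi)
    (h : Conditions sem ν cel) {I : NonemptyInterval T} (hI : GH ν .start false I)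
    {c' : M.Cfg} (hc' : Reaches M.step c c') (hhalt : M.step c' = none) : c'.state ∈ M.accept := by
  have hcel' : ∀ k < N, ∃ γ, cel[k]? = some γ := fun k hk => ⟨_, hcel k hk⟩
  -- By determinism the units follow the given computation. Its end is given, so the chain of units
  -- need not terminate by itself.
  have key : ∀ c', Reaches M.step c c' → ∃ e, UnitFor ν lo hi N e c' := by
    intro c' hc'
    induction hc' with
    | refl => exact ⟨false, unitFor_init hN hcel h hI⟩
    | @tail c₁ c₂ h₁ h₂ ih =>
      obtain ⟨e, he⟩ := ih
      rcases he.step hN hcel' h (hb _ h₁) with ⟨h₃, -⟩ | ⟨c₃, h₃, h₄⟩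
      · rw [h₃] at h₂; simp at h₂
      · rw [h₃] at h₂
        obtain rfl : c₃ = c₂ := by simpa using h₂
        exact ⟨_, h₄⟩
  obtain ⟨e, he⟩ := key c' hc'
  rcases he.step hN hcel' h (hb _ hc') with ⟨-, h₃⟩ | ⟨c₃, h₃, -⟩
  · exact h₃
  · rw [hhalt] at h₃; simp at h₃

end Soundness

end HS

namespace HS

open PolySpace StateTransition

/-! ### Accepting computations yield models of the clauses -/

section Completeness

variable {T : Type*} [LinearOrder T] {A : Type} {M : Machine A}

/-- The position of the marker of the window `a`: a low one unless the window `b` is `a`. -/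
def markPos {K : ℕ} (i : ℕ) (a b : Fin K) : ℕ := if a = b then 3 * i + 6 else 3 * i + 2

theorem markPos_le {K : ℕ} (i : ℕ) (a b : Fin K) : markPos i a b ≤ 3 * i + 6 := by
  unfold markPos; split_ifs <;> omega

theorem le_markPos {K : ℕ} (i : ℕ) (a b : Fin K) : 3 * i + 2 ≤ markPos i a b := by
  unfold markPos; split_ifs <;> omega

/-- The low position is inside the unit and the high one inside the next. The point `3 * i + 5`,
between the end of the unit and the high position, serves to refute `cov`. -/
theorem eq_of_le_markPos {K : ℕ} {i : ℕ} {a b : Fin K} (h : 3 * i + 3 ≤ markPos i a b) :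
    a = b := by
  unfold markPos at h
  by_contra hab
  rw [if_neg hab] at h
  omega

/-- The position of the marker of the `i`-th unit: a low one unless `i` is `m + 1`. -/
def haltPos (m i : ℕ) : ℕ := if i = m + 1 then 3 * i + 6 else 3 * i + 2

theorem haltPos_le (m i : ℕ) : haltPos m i ≤ 3 * i + 6 := by
  unfold haltPos; split_ifs <;> omega

theorem le_haltPos (m i : ℕ) : 3 * i + 2 ≤ haltPos m i := by
  unfold haltPos; split_ifs <;> omega

theorem eq_of_le_haltPos {m i : ℕ} (h : 3 * i + 3 ≤ haltPos m i) : i = m + 1 := by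
  unfold haltPos at h
  by_contra hab
  rw [if_neg hab] at h
  omega

/-- Global variables in the model of a computation of length `m`; the unit `i` is the interval
between the points `3 * i + 1` and `3 * i + 4`. -/
def GP (pt : ℕ → T) (m : ℕ) (e : Bool) (x y : T) : GVar → Prop
  | .start => x = pt 1 ∧ y = pt 4
  | .unit => ∃ i ≤ m, i.bodd = e ∧ x = pt (3 * i + 1) ∧ y = pt (3 * i + 4)
  | .pre => ∃ i ≤ m + 1, i.bodd = e ∧ x = pt (3 * i + 1) ∧ y = pt (3 * i + 4)
  | .mark => ∃ i ≤ m + 1, i.bodd = e ∧ x = pt (3 * i + 1) ∧ y = pt (haltPos m i)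
  | .low => ∃ i ≤ m + 1, i.bodd = e ∧ x = pt (3 * i + 1) ∧ y ≤ pt (haltPos m i)
  | .cov => ∃ i ≤ m + 1, i.bodd = e ∧ x = pt (3 * i + 1) ∧
      (y ≤ pt (3 * i + 4) ∨ pt (haltPos m i) ≤ y)
  | .far => ∃ i ≤ m + 1, i.bodd = e ∧ x ≤ pt (3 * i + 1) ∧ pt (3 * i + 4) ≤ y

/-- Local variables in the model of a computation; `ty i c` is the window of the cell
with index `c` at time `i`. -/
def LP (pt : ℕ → T) (m : ℕ) {K : ℕ} (ty : ℕ → ℕ → Fin K) (e : Bool) (a : Fin K)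
    (c : ℕ) (x y : T) : LVar → Prop
  | .mark => ∃ i ≤ m, i.bodd = e ∧ a ≤ ty i c ∧ x = pt (3 * i + 1) ∧ y = pt (markPos i a (ty i c))
  | .low => ∃ i ≤ m, i.bodd = e ∧ a ≤ ty i c ∧ x = pt (3 * i + 1) ∧ y ≤ pt (markPos i a (ty i c))
  | .cov => ∃ i ≤ m, i.bodd = e ∧ x = pt (3 * i + 1) ∧
      (y ≤ pt (3 * i + 4) ∨ a ≤ ty i c ∧ pt (markPos i a (ty i c)) ≤ y)
  | .seen => ∃ i ≤ m, i.bodd = e ∧ a ≤ ty i c ∧ pt (3 * i + 1) ≤ x ∧ x ≤ pt (markPos i a (ty i c)) ∧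
      pt (markPos i a (ty i c)) ≤ y

/-- The valuation of the model of a computation; `ty i c` is the window of the cell with index `c`
at time `i`. -/
def valuation (pt : ℕ → T) (m : ℕ) {K : ℕ} (ty : ℕ → ℕ → Fin K) (p : ℕ) :
    Set (NonemptyInterval T) :=
  {I | (∃ g e, gIdx g e = p ∧ GP pt m e I.fst I.snd g) ∨
    ∃ x e a c, lIdx x e a c = p ∧ LP pt m ty e a c I.fst I.snd x}

section

variable {pt : ℕ → T} {m K : ℕ} {ty : ℕ → ℕ → Fin K}

theorem GH_valuation {g : GVar} {e : Bool} {I : NonemptyInterval T} :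
    GH (valuation pt m ty) g e I ↔ GP pt m e I.fst I.snd g := by
  constructor
  · rintro (⟨g', e', h, hI⟩ | ⟨x, e', a, c, h, -⟩)
    · obtain ⟨rfl, rfl⟩ := gIdx_injective h
      exact hI
    · have := gIdx_lt g e
      unfold lIdx at h
      omega
  · exact fun h => .inl ⟨g, e, rfl, h⟩

theorem LH_valuation {x : LVar} {e : Bool} {a : Fin K} {c : ℕ} {I : NonemptyInterval T} :
    LH (valuation pt m ty) x e a c I ↔ LP pt m ty e a c I.fst I.snd x := by
  constructor
  · rintro (⟨g', e', h, hI⟩ | ⟨x, e', a, c, h, hI⟩)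
    · have := gIdx_lt g' e'
      unfold lIdx at h
      omega
    · obtain ⟨rfl, rfl, rfl, rfl⟩ := lIdx_injective h
      exact hI
  · exact fun h => .inr ⟨x, e, a, c, rfl, h⟩

variable (hpt : StrictMonoOn pt (Set.Iic (3 * m + 9))) {sem : IntervalRel → Semantics}

include hpt

theorem pt_le {i j : ℕ} (h : pt i ≤ pt j) (hi : i ≤ 3 * m + 9) (hj : j ≤ 3 * m + 9) : i ≤ j :=
  (hpt.le_iff_le hi hj).1 h

theorem pt_eq {i j : ℕ} (h : pt i = pt j) (hi : i ≤ 3 * m + 9) (hj : j ≤ 3 * m + 9) : i = j :=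
  hpt.injOn hi hj h

theorem pt_mono {i j : ℕ} (h : i ≤ j) (hj : j ≤ 3 * m + 9) : pt i ≤ pt j :=
  (hpt.le_iff_le (Set.mem_Iic.2 (h.trans hj)) hj).2 h

theorem pt_lt {i j : ℕ} (h : i < j) (hj : j ≤ 3 * m + 9) : pt i < pt j :=
  hpt (Set.mem_Iic.2 (h.le.trans hj)) hj h

/-- The interval between the points `i` and `j`. -/
theorem exists_interval {i j : ℕ} (h : i ≤ j) (hj : j ≤ 3 * m + 9) :
    ∃ I : NonemptyInterval T, I.fst = pt i ∧ I.snd = pt j :=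
  ⟨⟨(pt i, pt j), pt_mono hpt h hj⟩, rfl, rfl⟩

/-- `col` passes through an interval that ends at this left end. It must be proper under the
irreflexive reading, which is why the point `0` precedes the first unit. -/
theorem Col.intro {P : NonemptyInterval T → Prop} {I : NonemptyInterval T} {i n : ℕ}
    (hI : I.fst = pt (3 * i + 1)) (hn : 3 * i + 1 < n) (hn' : n ≤ 3 * m + 9)
    (hP : ∀ J : NonemptyInterval T, J.fst = pt (3 * i + 1) → J.snd = pt n → P J) :
    Col sem P I := by
  obtain ⟨J, hJ₁, hJ₂⟩ := exists_interval hpt (Nat.zero_le (3 * i + 1)) (by omega)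
  obtain ⟨J', hJ'₁, hJ'₂⟩ := exists_interval hpt hn.le hn'
  refine ⟨J, ⟨hJ₂.trans hI.symm, Semantics.lt_of_lt _ ?_⟩, J', ⟨hJ₂.trans hJ'₁.symm,
    Semantics.lt_of_lt _ ?_⟩, hP J' hJ'₁ hJ'₂⟩
  · rw [hJ₁, hJ₂]; exact pt_lt hpt (by omega) (by omega)
  · rw [hJ'₁, hJ'₂]; exact pt_lt hpt hn hn'

theorem after_intro {I : NonemptyInterval T} {i n : ℕ}
    (hI : I.snd = pt (3 * i + 1)) (hn : 3 * i + 1 < n) (hn' : n ≤ 3 * m + 9) :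
    ∃ J : NonemptyInterval T, IntervalRel.after.holds (sem .after) I J ∧ J.fst = pt (3 * i + 1) ∧
      J.snd = pt n := by
  obtain ⟨J, hJ₁, hJ₂⟩ := exists_interval hpt hn.le hn'
  refine ⟨J, ⟨hI.trans hJ₁.symm, Semantics.lt_of_lt _ ?_⟩, hJ₁, hJ₂⟩
  rw [hJ₁, hJ₂]
  exact pt_lt hpt hn hn'

theorem globalConditions_valuation (e : Bool) :
    GlobalConditions sem (valuation pt m ty) e where
  start_unit I h := by
    rw [GH_valuation] at h ⊢
    exact ⟨0, Nat.zero_le _, rfl, h⟩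
  unit_pre I h := by
    obtain ⟨i, hi, rfl, -, h₂⟩ := GH_valuation.1 h
    obtain ⟨J, hJ, hJ₁, hJ₂⟩ := after_intro hpt (sem := sem) (I := I) (i := i + 1)
      (n := 3 * (i + 1) + 4) h₂ (by omega) (by omega)
    exact ⟨J, hJ, GH_valuation.2 ⟨i + 1, by omega, Nat.bodd_succ i, hJ₁, hJ₂⟩⟩
  pre_mark I h := by
    obtain ⟨i, hi, rfl, h₁, -⟩ := GH_valuation.1 h
    have := le_haltPos m i
    have := haltPos_le m i
    exact Col.intro hpt h₁ (n := haltPos m i) (by omega) (by omega) fun J hJ₁ hJ₂ =>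
      GH_valuation.2 ⟨i, hi, rfl, hJ₁, hJ₂⟩
  mark_low I h := by
    rw [GH_valuation] at h ⊢
    obtain ⟨i, hi, he, h₁, h₂⟩ := h
    exact ⟨i, hi, he, h₁, h₂.le⟩
  mark_begins I h J hJ := by
    rw [GH_valuation] at h ⊢
    obtain ⟨i, hi, he, h₁, h₂⟩ := h
    exact ⟨i, hi, he, hJ.1 ▸ h₁, h₂ ▸ Semantics.le_of_lt hJ.2⟩
  mark_cov I h := by
    rw [GH_valuation] at h ⊢
    obtain ⟨i, hi, he, h₁, h₂⟩ := h
    exact ⟨i, hi, he, h₁, .inr h₂.ge⟩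
  mark_beginsInv I h J hJ := by
    rw [GH_valuation] at h ⊢
    obtain ⟨i, hi, he, h₁, h₂⟩ := h
    exact ⟨i, hi, he, hJ.1 ▸ h₁, .inr (h₂ ▸ Semantics.le_of_lt hJ.2)⟩
  pre_cov I h := by
    rw [GH_valuation] at h ⊢
    obtain ⟨i, hi, he, h₁, h₂⟩ := h
    exact ⟨i, hi, he, h₁, .inl h₂.le⟩
  pre_begins I h J hJ := by
    rw [GH_valuation] at h ⊢
    obtain ⟨i, hi, he, h₁, h₂⟩ := h
    exact ⟨i, hi, he, hJ.1 ▸ h₁, .inl (h₂ ▸ Semantics.le_of_lt hJ.2)⟩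
  cov_unit I h J hJ := by
    obtain ⟨i, hi, rfl, h₁, -⟩ := GH_valuation.1 (h J hJ)
    have him : i ≤ m := by
      -- The candidate `m + 1` has the high marker, so `cov` fails at its left end for the interval
      -- up to the point `3 * (m + 1) + 5`.
      by_contra him
      obtain rfl : i = m + 1 := by omega
      obtain ⟨J', hJ', hJ'₁, hJ'₂⟩ := after_intro hpt (sem := sem) (I := I) (i := m + 1)
        (n := 3 * (m + 1) + 5) (hJ.1.trans h₁) (by omega) (by omega)
      obtain ⟨i', hi', -, h₁', h₂'⟩ := GH_valuation.1 (h J' hJ')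
      have := pt_eq hpt (hJ'₁.symm.trans h₁') (by omega) (by omega)
      obtain rfl : i' = m + 1 := by omega
      have hp : haltPos m (m + 1) = 3 * (m + 1) + 6 := if_pos rfl
      rw [hJ'₂, hp] at h₂'
      rcases h₂' with h₂' | h₂' <;> have := pt_le hpt h₂' (by omega) (by omega) <;> omega
    exact Col.intro hpt h₁ (n := 3 * i + 4) (by omega) (by omega) fun J hJ₁ hJ₂ =>
      GH_valuation.2 ⟨i, him, rfl, hJ₁, hJ₂⟩
  pre_far I h J hJ := by
    rw [GH_valuation] at h ⊢
    obtain ⟨i, hi, he, h₁, h₂⟩ := h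
    exact ⟨i, hi, he, (hJ.1 ▸ h₁).le, h₂ ▸ Semantics.le_of_lt hJ.2⟩
  pre_far₁ I h J hJ J' hJ' := by
    rw [GH_valuation] at h ⊢
    obtain ⟨i, hi, he, h₁, h₂⟩ := h
    exact ⟨i, hi, he, hJ'.1 ▸ h₁ ▸ Semantics.le_of_lt hJ.1,
      h₂ ▸ hJ.2.le.trans (Semantics.le_of_lt hJ'.2)⟩
  unit_far I h J hJ := by
    rw [GH_valuation] at h ⊢
    obtain ⟨i, hi, he, h₁, h₂⟩ := h
    exact ⟨i, by omega, he, (hJ.1 ▸ h₁).le, h₂ ▸ Semantics.le_of_lt hJ.2⟩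
  unit_far₁ I h J hJ J' hJ' := by
    rw [GH_valuation] at h ⊢
    obtain ⟨i, hi, he, h₁, h₂⟩ := h
    exact ⟨i, by omega, he, hJ'.1 ▸ h₁ ▸ Semantics.le_of_lt hJ.1,
      h₂ ▸ hJ.2.le.trans (Semantics.le_of_lt hJ'.2)⟩

/-- For the selected window, or a larger one, the interval up to the point `3 * i + 5` would lack
`cov`. -/
theorem lt_of_cov {e : Bool} {a : Fin K} {c : ℕ} {I : NonemptyInterval T}
    (h : ∀ J, IntervalRel.after.holds (sem .after) I J → LH (valuation pt m ty) .cov e a c J)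
    {J : NonemptyInterval T} (hJ : IntervalRel.after.holds (sem .after) I J) :
    ∃ i ≤ m, i.bodd = e ∧ J.fst = pt (3 * i + 1) ∧ a < ty i c := by
  obtain ⟨i, hi, he, h₁, -⟩ := LH_valuation.1 (h J hJ)
  refine ⟨i, hi, he, h₁, ?_⟩
  obtain ⟨J', hJ', hJ'₁, hJ'₂⟩ := after_intro hpt (sem := sem) (I := I) (i := i)
    (n := 3 * i + 5) (hJ.1.trans h₁) (by omega) (by omega)
  obtain ⟨i', hi', -, h₁', h₂'⟩ := LH_valuation.1 (h J' hJ')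
  have := pt_eq hpt (hJ'₁.symm.trans h₁') (by omega) (by omega)
  obtain rfl : i' = i := by omega
  have hle := markPos_le i' a (ty i' c)
  rw [hJ'₂] at h₂'
  rcases h₂' with h₂' | ⟨h₃, h₂'⟩
  · have := pt_le hpt h₂' (by omega) (by omega)
    omega
  · have := pt_le hpt h₂' (by omega) (by omega)
    refine lt_of_le_of_ne h₃ fun hab => ?_
    rw [markPos, if_pos hab] at this
    omega

/-- A lower part of a later unit meets what is seen of an earlier unit only if the units are
consecutive and the window is the actual one. -/
theorem of_seen {e : Bool} {a : Fin K} {c i n : ℕ} {I : NonemptyInterval T} (hi : i ≤ m + 1)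
    (he : i.bodd = e) (hI : I.fst = pt (3 * i + 1)) (hn : n ≤ 3 * m + 9)
    (hIn : I.snd ≤ pt n) (hseen : LH (valuation pt m ty) .seen (!e) a c I) :
    ∃ j, i = j + 1 ∧ a = ty j c ∧ 3 * i + 3 ≤ n := by
  obtain ⟨j, hj, hje, ha, h₁, h₂, h₃⟩ := LH_valuation.1 hseen
  have hle := markPos_le j a (ty j c)
  rw [hI] at h₁ h₂
  have h₁ := pt_le hpt h₁ (by omega) (by omega)
  have h₂ := pt_le hpt h₂ (by omega) (by omega)
  have h₃ := pt_le hpt (h₃.trans hIn) (by omega) (by omega)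
  -- Parity keeps a unit from seeing itself; the length of the markers leaves only its successor.
  have hne : j ≠ i := by
    rintro rfl
    rw [he] at hje
    cases e <;> simp at hje
  obtain rfl : i = j + 1 := by omega
  have hab := eq_of_le_markPos (i := j) (a := a) (b := ty j c) (by omega)
  rw [markPos, if_pos hab] at h₃
  exact ⟨j, rfl, hab, by omega⟩

theorem low_start {b : Fin K} {c : ℕ}
    {I : NonemptyInterval T} (hI : GH (valuation pt m ty) .start false I)
    (h : LH (valuation pt m ty) .low false b c I) : b = ty 0 c := by
  obtain ⟨h₁, h₂⟩ := GH_valuation.1 hI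
  obtain ⟨i, hi, -, hb, h₃, h₄⟩ := LH_valuation.1 h
  have := pt_eq hpt (h₁.symm.trans h₃) (by omega) (by omega)
  obtain rfl : i = 0 := by omega
  have hle := markPos_le 0 b (ty 0 c)
  rw [h₂] at h₄
  have := pt_le hpt h₄ (by omega) (by omega)
  exact eq_of_le_markPos (i := 0) (by omega)

theorem of_low_seen {e : Bool} {a b : Fin K} {c c' : ℕ} {I : NonemptyInterval T}
    (hlow : LH (valuation pt m ty) .low e b c' I)
    (hseen : LH (valuation pt m ty) .seen (!e) a c I) :
    ∃ j < m, a = ty j c ∧ b = ty (j + 1) c' := by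
  obtain ⟨i, hi, he, hb, h₁, h₂⟩ := LH_valuation.1 hlow
  have hle := markPos_le i b (ty i c')
  obtain ⟨j, rfl, ha, h₃⟩ := of_seen hpt (by omega) he h₁ (by omega) h₂ hseen
  exact ⟨j, by omega, ha, eq_of_le_markPos (i := j + 1) (by omega)⟩

end

/-- Where `low` and `seen` of opposite parities meet, they belong to actual windows at consecutive
times (`of_low_seen`), so the excluded pairs reduce to the hypotheses on `ty`. -/
theorem cellConditions_valuation {pt : ℕ → T} {m : ℕ} {ty : ℕ → ℕ → Fin (numWin M)}
    (hpt : StrictMonoOn pt (Set.Iic (3 * m + 9))) {sem : IntervalRel → Semantics} {γ : Cel M}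
    {k : ℕ}
    (hmid : ∀ i < m, next (win M (ty i (k + 1))) = some (win M (ty (i + 1) (k + 1))).2.1)
    (hleft : ∀ i < m, next (win M (ty i (k + 1))) = some (win M (ty (i + 1) (k + 2))).1)
    (hright : ∀ i < m, next (win M (ty i (k + 1))) = some (win M (ty (i + 1) k)).2.2)
    (hacc : Accepting (win M (ty m (k + 1))).2.1)
    (hmid₀ : γ = (win M (ty 0 (k + 1))).2.1)
    (hleft₀ : γ = (win M (ty 0 (k + 2))).1)
    (hright₀ : γ = (win M (ty 0 k)).2.2)
    (e : Bool) (a b : Fin (numWin M)) :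
    CellConditions sem (valuation pt m ty) γ k e a b where
  unit_mark h0 I h := by
    obtain ⟨i, hi, rfl, h₁, -⟩ := GH_valuation.1 h
    have := markPos_le i a (ty i (k + 1))
    have := le_markPos i a (ty i (k + 1))
    exact Col.intro hpt h₁ (n := markPos i a (ty i (k + 1))) (by omega) (by omega)
      fun J hJ₁ hJ₂ => LH_valuation.2 ⟨i, hi, rfl, Fin.le_def.2 (by omega), hJ₁, hJ₂⟩
  mark_low I h := by
    rw [LH_valuation] at h ⊢
    obtain ⟨i, hi, he, ha, h₁, h₂⟩ := h
    exact ⟨i, hi, he, ha, h₁, h₂.le⟩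
  mark_begins I h J hJ := by
    rw [LH_valuation] at h ⊢
    obtain ⟨i, hi, he, ha, h₁, h₂⟩ := h
    exact ⟨i, hi, he, ha, hJ.1 ▸ h₁, h₂ ▸ Semantics.le_of_lt hJ.2⟩
  mark_cov I h := by
    rw [LH_valuation] at h ⊢
    obtain ⟨i, hi, he, ha, h₁, h₂⟩ := h
    exact ⟨i, hi, he, h₁, .inr ⟨ha, h₂.ge⟩⟩
  mark_beginsInv I h J hJ := by
    rw [LH_valuation] at h ⊢
    obtain ⟨i, hi, he, ha, h₁, h₂⟩ := h
    exact ⟨i, hi, he, hJ.1 ▸ h₁, .inr ⟨ha, h₂ ▸ Semantics.le_of_lt hJ.2⟩⟩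
  unit_cov I h := by
    rw [LH_valuation]
    obtain ⟨i, hi, he, h₁, h₂⟩ := GH_valuation.1 h
    exact ⟨i, hi, he, h₁, .inl h₂.le⟩
  unit_begins I h J hJ := by
    rw [LH_valuation]
    obtain ⟨i, hi, he, h₁, h₂⟩ := GH_valuation.1 h
    exact ⟨i, hi, he, hJ.1 ▸ h₁, .inl (h₂ ▸ Semantics.le_of_lt hJ.2)⟩
  cov_mark hb I h J hJ := by
    obtain ⟨i, hi, rfl, h₁, hlt⟩ := lt_of_cov hpt h hJ
    have := markPos_le i b (ty i (k + 1))
    have := le_markPos i b (ty i (k + 1))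
    rw [Fin.lt_def] at hlt
    exact Col.intro hpt h₁ (n := markPos i b (ty i (k + 1))) (by omega) (by omega)
      fun J hJ₁ hJ₂ => LH_valuation.2 ⟨i, hi, rfl, Fin.le_def.2 (by omega), hJ₁, hJ₂⟩
  cov_last ha I h J hJ := by
    obtain ⟨i, -, -, -, hlt⟩ := lt_of_cov hpt h hJ
    have := (ty i (k + 1)).2
    rw [Fin.lt_def] at hlt
    omega
  mark_seen I h := by
    rw [LH_valuation] at h ⊢
    obtain ⟨i, hi, he, ha, h₁, h₂⟩ := h
    exact ⟨i, hi, he, ha, h₁.ge, h₂ ▸ I.fst_le_snd, h₂.ge⟩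
  mark_seen₁ I h J hJ := by
    rw [LH_valuation] at h ⊢
    obtain ⟨i, hi, he, ha, h₁, h₂⟩ := h
    exact ⟨i, hi, he, ha, (hJ.1 ▸ h₁).ge, h₂ ▸ hJ.1 ▸ I.fst_le_snd,
      h₂ ▸ Semantics.le_of_lt hJ.2⟩
  mark_seen₂ I h J hJ := by
    rw [LH_valuation] at h ⊢
    obtain ⟨i, hi, he, ha, h₁, h₂⟩ := h
    exact ⟨i, hi, he, ha, h₁ ▸ Semantics.le_of_lt hJ.1, h₂ ▸ hJ.2 ▸ J.fst_le_snd,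
      h₂ ▸ hJ.2.le⟩
  mark_seen₃ I h J hJ J' hJ' := by
    rw [LH_valuation] at h ⊢
    obtain ⟨i, hi, he, ha, h₁, h₂⟩ := h
    exact ⟨i, hi, he, ha, h₁ ▸ hJ'.1 ▸ Semantics.le_of_lt hJ.1,
      h₂ ▸ hJ.2 ▸ hJ'.1 ▸ J.fst_le_snd, h₂ ▸ hJ.2 ▸ Semantics.le_of_lt hJ'.2⟩
  far_mark I h h' := by
    obtain ⟨i, hi, he, h₁, h₂⟩ := GH_valuation.1 h
    obtain ⟨j, hj, hje, -, h₃, h₄⟩ := LH_valuation.1 h'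
    have hle := markPos_le j a (ty j (k + 1))
    rw [h₃] at h₁
    rw [h₄] at h₂
    have h₁ := pt_le hpt h₁ (by omega) (by omega)
    have h₂ := pt_le hpt h₂ (by omega) (by omega)
    -- The left ends give `j ≤ i`, and `3 * i + 4 ≤ 3 * j + 6` gives `i ≤ j`; then the parities
    -- clash.
    obtain rfl : j = i := by omega
    rw [he] at hje
    cases e <;> simp at hje
  low_seen hna I h h' := by
    obtain ⟨i, hi, he, h₁, h₂⟩ := GH_valuation.1 h
    have hle := haltPos_le m i
    obtain ⟨j, hij, ha, h₃⟩ := of_seen hpt hi he h₁ (by omega) h₂ h'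
    have := eq_of_le_haltPos h₃
    obtain rfl : j = m := by omega
    exact hna (ha ▸ hacc)
  next_mid hne I h h' := by
    obtain ⟨j, hj, rfl, rfl⟩ := of_low_seen hpt h h'
    exact hne (hmid j hj)
  next_left hne I h h' := by
    obtain ⟨j, hj, rfl, rfl⟩ := of_low_seen hpt h h'
    exact hne (hleft j hj)
  next_right hne I h h' := by
    obtain ⟨j, hj, rfl, rfl⟩ := of_low_seen hpt h h'
    exact hne (hright j hj)
  start_mid hne I h h' := by
    obtain rfl := low_start hpt h h'
    exact hne hmid₀
  start_left hne I h h' := by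
    obtain rfl := low_start hpt h h'
    exact hne hleft₀
  start_right hne I h h' := by
    obtain rfl := low_start hpt h h'
    exact hne hright₀

theorem exists_trace {σ : Type*} {f : σ → Option σ} {a b : σ} (h : Reaches f a b) :
    ∃ (m : ℕ) (s : ℕ → σ), s 0 = a ∧ s m = b ∧ ∀ i < m, f (s i) = some (s (i + 1)) := by
  induction h using Relation.ReflTransGen.head_induction_on with
  | refl => exact ⟨0, fun _ => b, rfl, rfl, fun i hi => absurd hi (Nat.not_lt_zero i)⟩
  | @head a c hac _ ih =>
    obtain ⟨m, s, h₀, hm, hs⟩ := ih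
    refine ⟨m + 1, fun i => i.casesOn a s, rfl, hm, fun i hi => ?_⟩
    cases i with
    | zero => exact (congrArg (fun c => f a = some c) h₀).mpr hac
    | succ i => exact hs i (by omega)

/-- An accepting computation yields a model of the clauses over every order with sufficiently many
points. -/
theorem exists_conditions {lo hi : ℤ} {cel : List (Cel M)} {c c' : M.Cfg}
    (hcel : ∀ (k : ℕ) γ, cel[k]? = some γ → γ = cellAt lo hi c (lo - 1 + k))
    (hb : ∀ c', Reaches M.step c c' → lo ≤ c'.head ∧ c'.head ≤ hi)
    (hc' : Reaches M.step c c') (hhalt : M.step c' = none) (hacc : c'.state ∈ M.accept) :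
    ∃ n : ℕ, ∀ (T : Type*) [LinearOrder T], (Fin n ↪o T) → ∀ sem : IntervalRel → Semantics,
      ∃ (ν : ℕ → Set (NonemptyInterval T)) (I : NonemptyInterval T),
        GH ν .start false I ∧ Conditions sem ν cel := by
  obtain ⟨m, s, rfl, rfl, hs⟩ := exists_trace hc'
  -- The last point needed is the high marker of the candidate `m + 1`, at `3 * (m + 1) + 6`.
  refine ⟨3 * m + 10, fun T _ t sem => ?_⟩
  have hr : ∀ i ≤ m, Reaches M.step (s 0) (s i) := by
    intro i
    induction i with
    | zero => exact fun _ => .refl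
    | succ i ih => exact fun hi => (ih (by omega)).tail (hs i hi)
  -- List index `k` stands for the cell `lo - 1 + k` and has the variable index `k + 1`; hence the
  -- offset `2`.
  set ty : ℕ → ℕ → Fin (numWin M) := fun i c =>
    (win M).symm (windowAt lo hi (s i) (lo - 2 + c)) with hty
  have hwin : ∀ i c, win M (ty i c) = windowAt lo hi (s i) (lo - 2 + c) := fun i c =>
    (win M).apply_symm_apply _
  set pt : ℕ → T := fun n => t ⟨min n (3 * m + 9), by omega⟩ with hptd
  have hpt : StrictMonoOn pt (Set.Iic (3 * m + 9)) := by
    intro i hi j hj hij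
    rw [Set.mem_Iic] at hi hj
    exact t.strictMono (Fin.lt_def.2 (by simp only; omega))
  obtain ⟨I, hI₁, hI₂⟩ := exists_interval hpt (show 1 ≤ 4 by omega) (by omega)
  have hnext : ∀ i < m, ∀ z, next (windowAt lo hi (s i) z) = some (cellAt lo hi (s (i + 1)) z) :=
    fun i hi z => next_windowAt (hs i hi) (hb _ (hr i hi.le)) z
  refine ⟨valuation pt m ty, I, GH_valuation.2 ⟨hI₁, hI₂⟩,
    fun e => globalConditions_valuation hpt e, fun k γ hk e a b => ?_⟩
  have hγ := hcel k γ hk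
  refine cellConditions_valuation hpt ?_ ?_ ?_ ?_ ?_ ?_ ?_ e a b
  · intro i hi
    rw [hwin, hwin, hnext i hi]; rfl
  · intro i hi
    rw [hwin, hwin, hnext i hi, windowAt]
    congr 2; push_cast; ring
  · intro i hi
    rw [hwin, hwin, hnext i hi, windowAt]
    congr 2; push_cast; ring
  · rw [hwin]
    exact accepting_cellAt hhalt hacc _
  · rw [hγ, hwin, windowAt]
    congr 1; push_cast; ring
  · rw [hγ, hwin, windowAt]
    congr 1; push_cast; ring
  · rw [hγ, hwin, windowAt]
    congr 1; ring

end Completeness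

end HS

namespace HS

open PolySpace StateTransition StackProg

/-! ### The reduction -/

instance : Finite IntervalRel :=
  Finite.of_surjective (fun i : Fin 12 => match i with
    | 0 => IntervalRel.after | 1 => .begins | 2 => .ends | 3 => .during | 4 => .later
    | 5 => .overlaps | 6 => .afterInv | 7 => .beginsInv | 8 => .endsInv | 9 => .duringInv
    | 10 => .laterInv | 11 => .overlapsInv)
    fun g => by cases g <;> simp [Fin.exists_fin_succ]

instance : Finite Token :=
  Finite.of_surjective (fun i : Fin 8 ⊕ IntervalRel ⊕ IntervalRel => match i with
    | .inl 0 => Token.top | .inl 1 => .bot | .inl 2 => .tick | .inl 3 => .var | .inl 4 => .init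
    | .inl 5 => .imp | .inl 6 => .disj | .inl 7 => .and
    | .inr (.inl R) => .dia R
    | .inr (.inr R) => .box R)
    fun g => by cases g <;> simp [Fin.exists_fin_succ]

section Reduction

variable {A : Type} (M : Machine A) (c d : ℕ)

/-- The initial contents of the cells, for the input `w`. -/
def initCells (w : List A) : List (Cel M) :=
  cells (fun a => some (M.input a, none)) (some (M.blank, none)) none
    (Option.map fun x => (x.1, some M.start)) c d w

theorem length_initCells (w : List A) :
    (initCells M c d w).length = 2 * (c * (w.length + 1) ^ d) + w.length + 3 := by
  simp [initCells, cells]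
  ring

/-- With padding length `P`, the left border is the cell `-P - 1`, so the tape cell `0` is the list
entry `P + 1`. -/
theorem getElem?_initCells (w : List A) (k : ℕ)
    (hk : k < 2 * (c * (w.length + 1) ^ d) + w.length + 3) :
    (initCells M c d w)[k]? = some (cellAt (-(c * (w.length + 1) ^ d : ℕ))
      (w.length + (c * (w.length + 1) ^ d : ℕ)) (M.init w)
      (-(c * (w.length + 1) ^ d : ℕ) - 1 + k)) := by
  unfold initCells cells
  generalize c * (w.length + 1) ^ d = P at *
  cases k with
  | zero => simp [cellAt]
  | succ k =>
    rw [List.getElem?_cons_succ]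
    by_cases h₁ : k < P
    · rw [List.getElem?_append_left (by simpa using h₁), List.getElem?_replicate, if_pos h₁,
        cellAt, if_pos (by push_cast; omega), if_neg (by simp only [Machine.init]; push_cast; omega)]
      obtain ⟨j, hj⟩ : ∃ j : ℕ, -(P : ℤ) - 1 + (k + 1 : ℕ) = Int.negSucc j :=
        ⟨P - k - 1, by omega⟩
      rw [hj]
      rfl
    · obtain ⟨r, rfl⟩ := Nat.exists_eq_add_of_le (not_lt.1 h₁)
      rw [List.getElem?_append_right (by simp), List.length_replicate, Nat.add_sub_cancel_left,
        show -(P : ℤ) - 1 + (P + r + 1 : ℕ) = (r : ℤ) by push_cast; ring]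
      have htape : (M.init w).tape r = (w[r]?).elim M.blank M.input := rfl
      have hX : (w.map (fun a => (some (M.input a, none) : Cel M)) ++
          (List.replicate P (some (M.blank, none)) ++ [some (M.blank, none), none]))[r]? =
          some (if r ≤ w.length + P then some ((M.init w).tape r, none) else none) := by
        rw [htape]
        rcases lt_or_ge r w.length with h | h
        · rw [List.getElem?_append_left (by simpa using h), if_pos (by omega)]
          simp [h]
        · rw [List.getElem?_append_right (by simpa using h), List.length_map,
            List.getElem?_eq_none h]
          rcases lt_or_ge (r - w.length) P with h' | h'
          · rw [List.getElem?_append_left (by simpa using h'), if_pos (by omega)]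
            simp [h']
          · rw [List.getElem?_append_right (by simpa using h'), List.length_replicate]
            rcases Nat.lt_or_ge (w.length + P) r with h'' | h''
            · rw [show r - w.length - P = 1 by omega, if_neg (by omega)]
              rfl
            · rw [show r - w.length - P = 0 by omega, if_pos h'']
              rfl
      rw [List.getElem?_modifyHead, hX]
      have hr : (-(P : ℤ) ≤ r ∧ (r : ℤ) ≤ w.length + P) ↔ r ≤ w.length + P := by omega
      rcases Nat.eq_zero_or_pos r with h0 | h0
      · subst h0
        have : (0 : ℤ) ≤ w.length + P := by omega
        simp [cellAt, Machine.init, this]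
      · simp only [cellAt, hr, h0.ne', if_false]
        rw [if_neg (show ¬ (r : ℤ) = (M.init w).head by simp only [Machine.init]; omega)]

/-- The formula for the input `w`. -/
noncomputable def reduction (w : List A) : CoreFormula :=
  conj (instances numG (numL (numWin M)) cellClauses 0 (initCells M c d w) ++ globalClauses)
    (.init (G .start false))

/-- The program that computes the reduction. -/
noncomputable def reductionProg : Prog (Alph A (Cel M) Token) :=
  blockProg (fun a => some (M.input a, none)) (some (M.blank, none)) none
    (Option.map fun x => (x.1, some M.start)) c d (numL (numWin M)) Token.tick
    (fun γ => (cellClauses γ).flatMap fun φ => some .and :: φ.template numG)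
    ((globalClauses.flatMap fun ψ => .and :: ψ.encode) ++ (CoreFormula.init (G .start false)).encode)

theorem encode_reduction (w : List A) : (reduction M c d w).encode =
    blocks (numL (numWin M)) Token.tick
      (fun γ => (cellClauses γ).flatMap fun φ => some .and :: φ.template numG) 0
      (initCells M c d w) ++ ((globalClauses.flatMap fun ψ => .and :: ψ.encode) ++
        (CoreFormula.init (G .start false)).encode) := by
  rw [reduction, encode_conj, List.flatMap_append, List.append_assoc, blocks_eq]

theorem reduction_computable [Finite A] :
    Nonempty (Turing.TM2ComputableInPolyTime (id : List A → List A) CoreFormula.encode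
      (reduction M c d)) := by
  obtain ⟨time, h⟩ : PolyRun (reductionProg M c d) _ _ := polyRun_blockProg ..
  refine Prog.computableInPolyTime (reductionProg M c d) Stk.inp Stk.out time fun w => ?_
  rw [encode_reduction]
  exact h w

theorem holds_reduction {T : Type*} [LinearOrder T] {sem : IntervalRel → Semantics}
    {ν : ℕ → Set (NonemptyInterval T)} {w : List A} {I : NonemptyInterval T} :
    (reduction M c d w).Holds sem ν I ↔
      GH ν .start false I ∧ Conditions sem ν (initCells M c d w) := by
  rw [reduction, holds_conj]
  simp only [List.mem_append, or_imp, forall_and, forall_mem_instances, holds_globalClauses,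
    holds_cellClauses, Nat.zero_add]
  exact ⟨fun h => ⟨h.2, h.1.2, h.1.1⟩, fun h => ⟨⟨h.2.2, h.2.1⟩, h.1⟩⟩

end Reduction

/-- The stack program computes padding lengths of the form `c * (n + 1) ^ d`; the sum of the
coefficients, `p.eval 1`, serves as `c`. -/
theorem eval_le_pow (p : Polynomial ℕ) (n : ℕ) :
    p.eval n ≤ p.eval 1 * (n + 1) ^ p.natDegree := by
  rw [Polynomial.eval_eq_sum_range, Polynomial.eval_eq_sum_range, Finset.sum_mul]
  refine Finset.sum_le_sum fun i hi => ?_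
  rw [one_pow, mul_one]
  refine Nat.mul_le_mul_left _ ?_
  calc n ^ i ≤ (n + 1) ^ i := Nat.pow_le_pow_left (Nat.le_succ n) i
    _ ≤ (n + 1) ^ p.natDegree :=
      Nat.pow_le_pow_right n.succ_pos (Nat.lt_succ_iff.1 (Finset.mem_range.1 hi))

/-- Satisfiability of core formulas is PSPACE-hard over every class with arbitrarily large
orders. -/
theorem pSpaceHard_coreSat (sem : IntervalRel → Semantics) (C : Set LinOrd.{u})
    (hC : ∀ n : ℕ, ∃ T ∈ C, Nonempty (Fin n ↪o T)) :
    PSpaceHard CoreFormula.encode (CoreSat C sem) := by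
  intro A _ L ⟨M, p, hM⟩
  refine ⟨reduction M (p.eval 1) p.natDegree, reduction_computable M _ _, fun w => ?_⟩
  obtain ⟨hhead, cfg, hcfg, hhalt, hacc⟩ := hM w
  set P := p.eval 1 * (w.length + 1) ^ p.natDegree with hP
  have hb : ∀ c', Reaches M.step (M.init w) c' →
      -(P : ℤ) ≤ c'.head ∧ c'.head ≤ w.length + (P : ℕ) := by
    intro c' hc'
    have h₁ := hhead c' hc'
    have h₂ := eval_le_pow p w.length
    rw [← hP] at h₂
    rw [abs_le] at h₁
    omega
  have hcel := getElem?_initCells M (p.eval 1) p.natDegree w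
  have hlen := length_initCells M (p.eval 1) p.natDegree w
  rw [← hP] at hcel hlen
  rw [← hacc]
  constructor
  · intro ha
    obtain ⟨n, hn⟩ := exists_conditions (cel := initCells M (p.eval 1) p.natDegree w)
      (fun k γ hk => by
        have hkl := (List.getElem?_eq_some_iff.1 hk).1
        rw [hcel k (by omega), Option.some_inj] at hk
        exact hk.symm) hb hcfg hhalt ha
    obtain ⟨T, hT, ⟨t⟩⟩ := hC n
    obtain ⟨ν, I, hI⟩ := hn T t sem
    exact ⟨T, hT, ν, I, (holds_reduction M _ _).2 hI⟩
  · rintro ⟨T, -, ν, I, hI⟩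
    obtain ⟨hI, hcond⟩ := (holds_reduction M _ _).1 hI
    exact accepts_of_conditions (N := 2 * P + w.length + 3) (by push_cast; ring)
      hcel hb hcond hI hcfg hhalt

end HS

theorem mainTheorem5 (sem : HS.IntervalRel → HS.Semantics) :
    (∀ C : Set LinOrd.{u}, (∃ T ∈ C, Infinite T) →
      PolySpace.PSpaceHard HS.CoreFormula.encode (HS.CoreSat C sem)) ∧
    PolySpace.PSpaceHard HS.CoreFormula.encode
      (HS.CoreSat {T : LinOrd.{u} | Finite T} sem) := by
  refine ⟨fun C ⟨T, hT, _⟩ => HS.pSpaceHard_coreSat sem C fun n => ⟨T, hT, ?_⟩,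
    HS.pSpaceHard_coreSat sem _ fun n => ⟨LinOrd.of (ULift (Fin n)), ?_, ⟨?_⟩⟩⟩
  · obtain ⟨s, hs⟩ := Infinite.exists_subset_card_eq T n
    exact ⟨s.orderEmbOfFin hs⟩
  · exact inferInstanceAs (Finite (ULift (Fin n)))
  · exact ⟨⟨ULift.up, ULift.up_injective⟩, Iff.rfl⟩
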